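/- Let $d\ge 1$, let $\boldsymbol m=(m_1,\dots,m_d)$ be a vector of positive integers, and put $\underline{\boldsymbol m}=\min_i m_i$, $\overline{\boldsymbol m}=\max_i m_i$. For an open set $\Omega\subseteq\mathbb R^d$ and $1\le p\le\infty$ let $W^{\boldsymbol m}_p(\Omega)$ be the anisotropic Sobolev space of all real-valued functions $u$ on $\Omega$ whose weak derivatives $D^{\boldsymbol\alpha}u$ exist and belong to $L_p(\Omega)$ for all multi-indices $\boldsymbol\alpha\in\mathbb N_0^d$ with $\sum_{i=1}^d \alpha_i/m_i\le 1$, with the norm $$\|u\|_{\boldsymbol m,p}=\sum_{\sum_i\alpha_i/m_i\le 1}\|D^{\boldsymbol\alpha}u\|_{L_p(\Omega)} .$$ For $\rho>0$ and $0<\kappa\le\pi$, the finite cone with vertex $x$, axis direction $v\ne 0$, height $\rho$ and aperture angle $\kappa$ is the set consisting of $x$ and of all $y\neq x$ with $|y-x|\le\rho$ and $\angle(y-x,v)\le\kappa/2$; $\Omega$ satisfies the cone condition with a cone of dimensions $\rho,\kappa$ if every $x\in\Omega$ is the vertex of such a cone (with some axis direction depending on $x$) that is contained in $\Omega$. **Theorem.**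 Let $1\le p\le q\le\infty$, and suppose that * either $\underline{\boldsymbol m}\,p>d$ (and $p\le q\le\infty$ is arbitrary), * or $\overline{\boldsymbol m}\,p<d$ and $q\le p^*=dp/(d-\underline{\boldsymbol m}\,p)$. Let $\rho>0$ and $0<\kappa\le\pi$. Then there is a constant $K$, depending only on $\boldsymbol m,d,p,q,\rho,\kappa$, such that for every open set $\Omega\subseteq\mathbb R^d$ satisfying the cone condition with a cone of dimensions $\rho,\kappa$ and for all $u\in W^{\boldsymbol m}_p(\Omega)$, $$\|u\|_{L_q(\Omega)}\le K\,\|u\|_{\boldsymbol m,p}^{\theta}\,\|u\|_{L_p(\Omega)}^{1-\theta},\qquad \theta=\frac{d}{\underline{\boldsymbol m}\,p}-\frac{d}{\underline{\boldsymbol m}\,q}$$ (with $1/\infty=0$ and $0^0=1$). -/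

import Mathlib

open MeasureTheory
open scoped ENNReal NNReal ContDiff

namespace AnisoSobolev

/-- The smallest entry of `m`. -/
noncomputable def minEntry {d : ℕ} (m : Fin d → ℕ) : ℕ := ⨅ i, m i

/-- The largest entry of `m`. -/
noncomputable def maxEntry {d : ℕ} (m : Fin d → ℕ) : ℕ := ⨆ i, m i

/-- The multi-indices `α` with `∑ i, α i / m i ≤ 1`, as a finite set
(if all `m i ≥ 1`, then this inequality forces `α ≤ m`, see `mem_dom`). -/
def dom {d : ℕ} (m : Fin d → ℕ) : Finset (Fin d → ℕ) :=
  (Finset.Icc 0 m).filter fun α => ∑ i, (α i : ℚ) / (m i : ℚ) ≤ 1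

theorem mem_dom {d : ℕ} {m : Fin d → ℕ} (hm : ∀ i, 1 ≤ m i) (α : Fin d → ℕ) :
    α ∈ dom m ↔ ∑ i, (α i : ℚ) / (m i : ℚ) ≤ 1 := by
  simp only [dom, Finset.mem_filter, Finset.mem_Icc, and_iff_right_iff_imp]
  intro h
  refine ⟨fun i => Nat.zero_le _, fun i => ?_⟩
  have hpos : (0 : ℚ) < m i := by exact_mod_cast hm i
  have h1 : (α i : ℚ) / (m i : ℚ) ≤ ∑ j, (α j : ℚ) / (m j : ℚ) :=
    Finset.single_le_sum (f := fun j => (α j : ℚ) / (m j : ℚ))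
      (fun j _ => by positivity) (Finset.mem_univ i)
  have h2 := (div_le_one hpos).1 (h1.trans h)
  exact_mod_cast h2

/-- The classical partial derivative in the direction of the `i`-th coordinate. -/
noncomputable def partialDeriv {d : ℕ} (i : Fin d) (φ : EuclideanSpace ℝ (Fin d) → ℝ) :
    EuclideanSpace ℝ (Fin d) → ℝ :=
  fun x => fderiv ℝ φ x (EuclideanSpace.single i 1)

/-- The classical derivative `∂₁^{α₁} ⋯ ∂_d^{α_d} φ`. -/
noncomputable def multiDeriv {d : ℕ} (α : Fin d → ℕ) (φ : EuclideanSpace ℝ (Fin d) → ℝ) :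
    EuclideanSpace ℝ (Fin d) → ℝ :=
  (List.finRange d).foldr (fun i ψ => (partialDeriv i)^[α i] ψ) φ

/-- `v` is the weak derivative `D^α u` on the open set `Ω`. Functions on `Ω` are represented by
functions on the whole space, whose values outside `Ω` play no role. -/
def HasWeakDeriv {d : ℕ} (Ω : Set (EuclideanSpace ℝ (Fin d))) (α : Fin d → ℕ)
    (u v : EuclideanSpace ℝ (Fin d) → ℝ) : Prop :=
  LocallyIntegrableOn u Ω ∧ LocallyIntegrableOn v Ω ∧
    ∀ φ : EuclideanSpace ℝ (Fin d) → ℝ, ContDiff ℝ ∞ φ → HasCompactSupport φ → tsupport φ ⊆ Ω →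
      ∫ x in Ω, u x * multiDeriv α φ x = (-1) ^ (∑ i, α i) * ∫ x in Ω, v x * φ x

open Classical in
/-- A representative of the weak derivative `D^α u` on `Ω` (unique up to a null subset of `Ω`). -/
noncomputable def weakDeriv {d : ℕ} (Ω : Set (EuclideanSpace ℝ (Fin d))) (α : Fin d → ℕ)
    (u : EuclideanSpace ℝ (Fin d) → ℝ) : EuclideanSpace ℝ (Fin d) → ℝ :=
  if h : ∃ v, HasWeakDeriv Ω α u v then h.choose else 0

/-- Membership in the anisotropic Sobolev space `W^m_p(Ω)`. -/
def MemSobolev {d : ℕ} (Ω : Set (EuclideanSpace ℝ (Fin d))) (m : Fin d → ℕ) (p : ℝ≥0∞)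
    (u : EuclideanSpace ℝ (Fin d) → ℝ) : Prop :=
  ∀ α ∈ dom m, ∃ v, HasWeakDeriv Ω α u v ∧ MemLp v p (volume.restrict Ω)

/-- The norm of `W^m_p(Ω)`: the sum of `‖D^α u‖_{L_p(Ω)}` over `α ∈ dom m`. -/
noncomputable def sobolevNorm {d : ℕ} (Ω : Set (EuclideanSpace ℝ (Fin d))) (m : Fin d → ℕ)
    (p : ℝ≥0∞) (u : EuclideanSpace ℝ (Fin d) → ℝ) : ℝ≥0∞ :=
  ∑ α ∈ dom m, eLpNorm (weakDeriv Ω α u) p (volume.restrict Ω)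

/-- The finite cone with vertex `x`, axis direction `v`, height `ρ` and aperture angle `κ`. -/
def finiteCone {d : ℕ} (x v : EuclideanSpace ℝ (Fin d)) (ρ κ : ℝ) :
    Set (EuclideanSpace ℝ (Fin d)) :=
  {y | y = x ∨ (‖y - x‖ ≤ ρ ∧ InnerProductGeometry.angle (y - x) v ≤ κ / 2)}

/-- The cone condition for `Ω` with a cone of height `ρ` and aperture angle `κ`: every point of `Ω`
is the vertex of a finite cone with these dimensions that is contained in `Ω`. Two finite cones are
congruent if and only if they can be given the same height and aperture angle. -/
def ConeCondition {d : ℕ} (Ω : Set (EuclideanSpace ℝ (Fin d))) (ρ κ : ℝ) : Prop :=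
  ∀ x ∈ Ω, ∃ v : EuclideanSpace ℝ (Fin d), v ≠ 0 ∧ finiteCone x v ρ κ ⊆ Ω

/-- The exponent `θ = d / (m_min p) - d / (m_min q)`, where `1 / ∞ = 0`. -/
noncomputable def theta {d : ℕ} (m : Fin d → ℕ) (p q : ℝ≥0∞) : ℝ :=
  (d : ℝ) / (minEntry m : ℝ) * (p⁻¹).toReal - (d : ℝ) / (minEntry m : ℝ) * (q⁻¹).toReal

end AnisoSobolev

namespace AnisoSobolev

/-! Write `k` for the smallest entry of `m`. Every multi-index of order at most `k` lies in `dom m`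
(`mem_dom_of_sum_le`), so an anisotropic Sobolev function has all isotropic weak derivatives up to
order `k` in `L_p`, and their norms are part of the anisotropic norm. It is therefore enough to
prove the estimate for isotropic jets of order `k` (`IsWeakJet`), extended by zero off `Ω`.

The cone condition enters only through compactness: finitely many centres `c` and one radius `δ`,
independent of `Ω`, are such that from every point of `Ω` all segments towards the ball `closedBall
c δ`, for one of these centres, stay in `Ω` (`exists_finset_forall_coneCondition`). This makes the
constant uniform in `Ω`. No extension operator and no density of smooth functions is used; weak
derivatives are handled directly through the fundamental theorem of calculus on almost every segment
(`HasWeakDirDeriv.ae_sub_eq_integral`).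

If `kp < d`, each ball contains a basis of directions. Bounding a truncated power of `|u|` by its
line integral in each of these directions and multiplying the bounds (Loomis–Whitney) gives the
first-order inequality `exists_lintegral_rpow_le_first_order`. Applying it `k` times reaches the
exponent `dp/(d - kp)`, and Hölder interpolation with `L_p` gives the smaller `q`.

If `kp > d`, a `k`-th finite difference with step `v` expresses `u x` by the shifts `u (x + l v)`
and an iterated average of derivatives along `v`. Averaging over `v` in a ball of size comparable to
`r` gives, almost everywhere, `|u| ≤ C (r^(-d/p) ‖u‖_p + r^(k-d/p) N)` with `N` the jet norm
(`exists_ae_enorm_le_of_isWeakJet`). The choice `r = (‖u‖_p / N)^(1/k)` yields the `L_∞` bound, and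
interpolation with `L_p` gives finite `q`. -/

theorem isOpen_setOf_forall_add_mem {E : Type*} [NormedAddCommGroup E] {Ω C : Set E}
    (hΩ : IsOpen Ω) (hC : IsCompact C) :
    IsOpen {x : E | ∀ c ∈ C, x + c ∈ Ω} := by
  rw [isOpen_iff_mem_nhds]
  intro x hx
  refine hC.eventually_forall_of_forall_eventually (x₀ := x) (P := fun x c => x + c ∈ Ω)
    fun c hc => ?_
  have : ContinuousAt (fun z : E × E => z.1 + z.2) (x, c) := by fun_prop
  exact this.eventually_mem (hΩ.mem_nhds (hx c hc))

theorem isOpen_setOf_forall_add_smul_mem {E : Type*} [NormedAddCommGroup E] [NormedSpace ℝ E]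
    {Ω : Set E} (hΩ : IsOpen Ω) (v : E) (a b : ℝ) :
    IsOpen {x : E | ∀ s ∈ Set.Icc a b, x + s • v ∈ Ω} := by
  have h := isOpen_setOf_forall_add_mem hΩ
    ((isCompact_Icc (a := a) (b := b)).image (f := fun s : ℝ => s • v) (by fun_prop))
  simp only [Set.forall_mem_image] at h
  exact h

/-! ### Weak derivatives along almost every segment. -/

section Lines

variable {E : Type*} [NormedAddCommGroup E] [InnerProductSpace ℝ E] [FiniteDimensional ℝ E]
  [MeasurableSpace E] [BorelSpace E]

theorem measurePreserving_shear (ν : Measure ℝ) [SFinite ν] (v : E) :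
    MeasurePreserving (fun z : ℝ × E => (z.1, z.2 + z.1 • v))
      (ν.prod (volume : Measure E)) (ν.prod volume) :=
  (MeasurePreserving.id ν).skew_product (g := fun (s : ℝ) (x : E) => x + s • v)
    (by simp only [Function.uncurry_def]; fun_prop)
    (Filter.Eventually.of_forall fun s => map_add_right_eq_self volume (s • v))

theorem ae_ae_add_smul {P : E → Prop} (h : ∀ᵐ x, P x) (v : E) (ν : Measure ℝ) [SFinite ν] :
    ∀ᵐ x, ∀ᵐ s ∂ν, P (x + s • v) := by
  have h1 : ∀ᵐ z ∂(ν.prod (volume : Measure E)), P (z.2 + z.1 • v) :=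
    ((measurePreserving_shear ν v).quasiMeasurePreserving.ae
      (Measure.quasiMeasurePreserving_snd.ae h))
  have h2 : ∀ᵐ z ∂((volume : Measure E).prod ν), P (z.1 + z.2 • v) :=
    (Measure.measurePreserving_swap (μ := (volume : Measure E)) (ν := ν)).quasiMeasurePreserving.ae
      h1
  exact Measure.ae_ae_of_ae_prod h2

/-- Only the values of `g` on the compact set swept out by the segments matter; after cutting off
there, the shear map preserves the product measure. -/
theorem integrable_line_restrict {g : E → ℝ} (hg : LocallyIntegrable g) {K : Set E}
    (hK : IsCompact K) (v : E) (a b : ℝ) :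
    Integrable (fun z : ℝ × E => g (z.2 + z.1 • v))
      ((volume.restrict (Set.Icc a b)).prod (volume.restrict K)) := by
  set K' : Set E := (fun z : ℝ × E => z.2 + z.1 • v) '' (Set.Icc a b ×ˢ K) with hK'
  have hK'c : IsCompact K' := (isCompact_Icc.prod hK).image (by fun_prop)
  have h1 : Integrable (K'.indicator g) :=
    (integrable_indicator_iff hK'c.measurableSet).2 (hg.integrableOn_isCompact hK'c)
  have h2 : Integrable (fun z : ℝ × E => K'.indicator g (z.2 + z.1 • v))
      ((volume.restrict (Set.Icc a b)).prod volume) :=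
    (measurePreserving_shear (volume.restrict (Set.Icc a b)) v).integrable_comp_of_integrable
      (h1.comp_snd (volume.restrict (Set.Icc a b)))
  have h3 : (volume.restrict (Set.Icc a b)).prod (volume.restrict K) =
      (((volume : Measure ℝ).prod (volume : Measure E)).restrict (Set.Icc a b ×ˢ K)) :=
    Measure.prod_restrict _ _
  have h4 : (volume.restrict (Set.Icc a b)).prod (volume.restrict K) ≤
      (volume.restrict (Set.Icc a b)).prod (volume : Measure E) :=
    Measure.prod_mono le_rfl Measure.restrict_le_self
  refine (h2.mono_measure h4).congr ?_
  rw [h3]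
  filter_upwards [ae_restrict_mem (measurableSet_Icc.prod hK.measurableSet)] with z hz
  exact Set.indicator_of_mem (Set.mem_image_of_mem _ hz) g

theorem integrable_line_mul {g : E → ℝ} (hg : LocallyIntegrable g) {ψ : E → ℝ}
    (hψ : Continuous ψ) (hc : HasCompactSupport ψ) (v : E) (a b : ℝ) :
    Integrable (fun z : ℝ × E => g (z.2 + z.1 • v) * ψ z.2)
      ((volume.restrict (Set.Icc a b)).prod volume) := by
  have h1 := integrable_line_restrict hg hc v a b
  obtain ⟨C, hC⟩ := hψ.bounded_above_of_compact_support hc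
  have h2 : Integrable (fun z : ℝ × E => g (z.2 + z.1 • v) * ψ z.2)
      ((volume.restrict (Set.Icc a b)).prod (volume.restrict (tsupport ψ))) :=
    h1.mul_bdd (c := C) (hψ.comp continuous_snd).aestronglyMeasurable
      (Filter.Eventually.of_forall fun z => hC z.2)
  have h3 : (volume.restrict (Set.Icc a b)).prod (volume.restrict (tsupport ψ)) =
      ((volume.restrict (Set.Icc a b)).prod (volume : Measure E)).restrict
        (Set.univ ×ˢ tsupport ψ) := by
    rw [← Measure.prod_restrict, Measure.restrict_univ]
  rw [h3] at h2
  refine (integrableOn_iff_integrable_of_support_subset ?_).1 h2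
  intro z hz
  refine ⟨trivial, subset_tsupport _ ?_⟩
  intro h0
  exact hz (by simp [h0])

theorem ae_forall_intervalIntegrable_line {g : E → ℝ} (hg : LocallyIntegrable g) (v : E) :
    ∀ᵐ x, ∀ a b : ℝ, IntervalIntegrable (fun s : ℝ => g (x + s • v)) volume a b := by
  have h1 : ∀ n : ℕ, ∀ᵐ x, x ∈ Metric.closedBall (0 : E) n →
      IntegrableOn (fun s : ℝ => g (x + s • v)) (Set.Icc (-(n : ℝ)) n) := by
    intro n
    rw [← ae_restrict_iff' measurableSet_closedBall]
    exact (integrable_line_restrict hg (isCompact_closedBall (0 : E) n) v (-n) n).prod_left_ae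
  filter_upwards [ae_all_iff.2 h1] with x hx a b
  obtain ⟨n, hn⟩ := exists_nat_ge (max ‖x‖ (max |a| |b|))
  have hxn : x ∈ Metric.closedBall (0 : E) n := by
    simpa using (le_max_left _ _).trans hn
  have ha : |a| ≤ n := ((le_max_left _ _).trans (le_max_right _ _)).trans hn
  have hb : |b| ≤ n := ((le_max_right _ _).trans (le_max_right _ _)).trans hn
  rw [intervalIntegrable_iff]
  refine (hx n hxn).mono_set fun s hs => ?_
  have := Set.uIoc_subset_uIcc hs
  rw [Set.mem_uIcc] at this
  rw [abs_le] at ha hb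
  constructor <;> rcases this with h | h <;> linarith [h.1, h.2]

/-- `g` is the weak derivative of `u` on `Ω` in the direction `v`. -/
def HasWeakDirDeriv (Ω : Set E) (v : E) (u g : E → ℝ) : Prop :=
  ∀ φ : E → ℝ, ContDiff ℝ ∞ φ → HasCompactSupport φ → tsupport φ ⊆ Ω →
    ∫ x, u x * fderiv ℝ φ x v = - ∫ x, g x * φ x

/-- A weakly differentiable function satisfies the fundamental theorem of calculus on almost
all segments of a given direction. -/
theorem HasWeakDirDeriv.ae_sub_eq_integral {Ω : Set E} (hΩ : IsOpen Ω) {v : E} {u g : E → ℝ}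
    (hu : LocallyIntegrable u) (hg : LocallyIntegrable g) (h : HasWeakDirDeriv Ω v u g)
    {t : ℝ} (ht0 : 0 ≤ t) (ht1 : t ≤ 1) :
    ∀ᵐ x, (∀ s ∈ Set.Icc (0 : ℝ) 1, x + s • v ∈ Ω) →
      u (x + t • v) - u x = ∫ s in (0 : ℝ)..t, g (x + s • v) := by
  have hA := isOpen_setOf_forall_add_smul_mem hΩ v 0 1
  have huI : Set.uIoc 0 t ⊆ Set.Icc (0 : ℝ) 1 := by
    rw [Set.uIoc_of_le ht0]
    exact fun s hs => ⟨hs.1.le, hs.2.trans ht1⟩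
  have hle : volume.restrict (Set.uIoc 0 t) ≤ volume.restrict (Set.Icc (0 : ℝ) 1) :=
    Measure.restrict_mono_set _ huI
  have hloc : LocallyIntegrable fun x => u (x + t • v) := by
    rw [locallyIntegrable_iff]
    intro K hK
    have hK2 := hK.image (f := fun x => x + t • v) (by fun_prop)
    have := hu.integrableOn_isCompact hK2
    rwa [(measurePreserving_add_right volume (t • v)).integrableOn_image
      (measurableEmbedding_addRight (t • v))] at this
  have hgloc : LocallyIntegrable fun x => ∫ s in (0 : ℝ)..t, g (x + s • v) := by
    rw [locallyIntegrable_iff]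
    intro K hK
    have h1 := (integrable_line_restrict hg hK v 0 1).mono_measure
      (Measure.prod_mono hle le_rfl)
    have := h1.integral_prod_right
    simp only [intervalIntegral.integral_of_le ht0]
    rw [Set.uIoc_of_le ht0] at this
    exact this
  -- The points whose whole segment lies in `Ω` form an open set, so it suffices to test against
  -- smooth functions `φ` supported there.
  have key := hA.ae_eq_zero_of_integral_contDiff_smul_eq_zero (μ := (volume : Measure E))
    (f := fun x => u (x + t • v) - u x - ∫ s in (0 : ℝ)..t, g (x + s • v))
    (((hloc.sub hu).sub hgloc).locallyIntegrableOn _) ?_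
  · filter_upwards [key] with x hx hxA
    exact sub_eq_zero.1 (hx hxA)
  intro φ hφ hφc hφA
  have hφcont : Continuous φ := hφ.continuous
  have hDcont : Continuous fun x => fderiv ℝ φ x v :=
    (hφ.continuous_fderiv (by simp)).clm_apply continuous_const
  have hDc : HasCompactSupport fun x => fderiv ℝ φ x v := hφc.fderiv_apply ℝ v
  have hint1 : Integrable (fun z : ℝ × E => g (z.2 + z.1 • v) * φ z.2)
      ((volume.restrict (Set.uIoc 0 t)).prod volume) :=
    (integrable_line_mul hg hφcont hφc v 0 1).mono_measure (Measure.prod_mono hle le_rfl)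
  have hint2 : Integrable (fun z : ℝ × E => u z.2 * - fderiv ℝ φ (z.2 - z.1 • v) v)
      ((volume.restrict (Set.uIoc 0 t)).prod volume) := by
    have h1 : Integrable (fun z : ℝ × E => u (z.2 + z.1 • v) * fderiv ℝ φ z.2 v)
        ((volume.restrict (Set.uIoc 0 t)).prod volume) :=
      (integrable_line_mul hu hDcont hDc v 0 1).mono_measure (Measure.prod_mono hle le_rfl)
    have h2 := ((measurePreserving_shear (volume.restrict (Set.uIoc 0 t))
      (-v)).integrable_comp_of_integrable h1).neg
    refine h2.congr (Filter.Eventually.of_forall fun z => ?_)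
    simp [Function.comp, sub_eq_add_neg]
  -- For `φ` supported in that set, every translate `φ (· - s • v)` with `s ∈ [0, 1]` is supported
  -- in `Ω` and hence admissible in the weak formulation.
  have hsm : ∀ s : ℝ, s ∈ Set.Icc (0 : ℝ) 1 →
      ∫ y, g y * φ (y - s • v) = ∫ y, u y * - fderiv ℝ φ (y - s • v) v := by
    intro s hs
    have e1 : ContDiff ℝ ∞ fun y => φ (y - s • v) := hφ.comp (by fun_prop)
    have e2 : HasCompactSupport fun y => φ (y - s • v) :=
      hφc.comp_homeomorph (Homeomorph.subRight (s • v))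
    have e3 : tsupport (fun y => φ (y - s • v)) ⊆ Ω := by
      have : tsupport (fun y => φ (y - s • v)) =
          (Homeomorph.subRight (s • v)) ⁻¹' tsupport φ :=
        tsupport_comp_eq_preimage φ (Homeomorph.subRight (s • v))
      rw [this]
      intro y hy
      have := hφA hy s hs
      simpa using this
    have e4 := h _ e1 e2 e3
    have e5 : ∀ y, fderiv ℝ (fun y => φ (y - s • v)) y v = fderiv ℝ φ (y - s • v) v := by
      intro y
      rw [fderiv_comp_sub]
    simp only [e5] at e4
    simp only [mul_neg, integral_neg, e4, neg_neg]
  have hswap1 := intervalIntegral_integral_swap (μ := (volume : Measure E)) (a := 0) (b := t)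
    (f := fun s x => g (x + s • v) * φ x) hint1
  have hswap2 := intervalIntegral_integral_swap (μ := (volume : Measure E)) (a := 0) (b := t)
    (f := fun s y => u y * - fderiv ℝ φ (y - s • v) v) hint2
  -- Integrating the weak identity over `s` moves the fundamental theorem of calculus from `u` onto
  -- the smooth function `φ`.
  have hftc : ∀ y, ∫ s in (0 : ℝ)..t, u y * - fderiv ℝ φ (y - s • v) v =
      u y * φ (y - t • v) - u y * φ y := by
    intro y
    rw [intervalIntegral.integral_const_mul, ← mul_sub]
    congr 1
    have hd : ∀ s : ℝ, HasDerivAt (fun s : ℝ => φ (y - s • v)) (-fderiv ℝ φ (y - s • v) v) s := by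
      intro s
      have h1 : HasDerivAt (fun s : ℝ => y - s • v) (-v) s := by
        simpa using ((hasDerivAt_id s).smul_const v).const_sub y
      have h2 := ((hφ.differentiable (by simp)) (y - s • v)).hasFDerivAt.comp_hasDerivAt s h1
      rw [map_neg] at h2
      exact h2
    rw [intervalIntegral.integral_eq_sub_of_hasDerivAt (fun s _ => hd s)]
    · simp
    · exact (Continuous.neg (hDcont.comp (by fun_prop))).intervalIntegrable _ _
  have i0 : Integrable fun x => u x * φ x := by
    simpa [mul_comm] using hu.integrable_smul_left_of_hasCompactSupport hφcont hφc
  have i1 : Integrable fun x => u (x + t • v) * φ x := by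
    simpa [mul_comm] using hloc.integrable_smul_left_of_hasCompactSupport hφcont hφc
  have i2 : Integrable fun x => (∫ s in (0 : ℝ)..t, g (x + s • v)) * φ x := by
    simpa [mul_comm] using hgloc.integrable_smul_left_of_hasCompactSupport hφcont hφc
  have i1' : Integrable fun y => u y * φ (y - t • v) := by
    have := i1.comp_sub_right (t • v)
    simpa using this
  have tr : ∫ x, u (x + t • v) * φ x = ∫ y, u y * φ (y - t • v) := by
    have := integral_add_right_eq_self (μ := (volume : Measure E))
      (fun y => u y * φ (y - t • v)) (t • v)
    simpa using this
  have eq1 : ∫ x, (∫ s in (0 : ℝ)..t, g (x + s • v)) * φ x =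
      ∫ s in (0 : ℝ)..t, ∫ x, g (x + s • v) * φ x := by
    rw [hswap1]
    refine integral_congr_ae (Filter.Eventually.of_forall fun x => ?_)
    simp only [intervalIntegral.integral_mul_const]
  have eq2 : ∫ s in (0 : ℝ)..t, ∫ x, g (x + s • v) * φ x =
      ∫ s in (0 : ℝ)..t, ∫ y, u y * - fderiv ℝ φ (y - s • v) v := by
    refine intervalIntegral.integral_congr fun s hs => ?_
    rw [Set.uIcc_of_le ht0] at hs
    rw [← hsm s ⟨hs.1, hs.2.trans ht1⟩]
    have := integral_add_right_eq_self (μ := (volume : Measure E))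
      (fun y => g y * φ (y - s • v)) (s • v)
    simpa using this
  have eq3 : ∫ x, (∫ s in (0 : ℝ)..t, g (x + s • v)) * φ x =
      (∫ x, u (x + t • v) * φ x) - ∫ x, u x * φ x := by
    rw [eq1, eq2, hswap2, tr, ← integral_sub i1' i0]
    exact integral_congr_ae (Filter.Eventually.of_forall hftc)
  have : ∀ x, φ x • (u (x + t • v) - u x - ∫ s in (0 : ℝ)..t, g (x + s • v)) =
      (u (x + t • v) * φ x - u x * φ x) - (∫ s in (0 : ℝ)..t, g (x + s • v)) * φ x := by
    intro x; simp only [smul_eq_mul]; ring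
  simp only [this]
  rw [integral_sub (f := fun x => u (x + t • v) * φ x - u x * φ x) (i1.sub i0) i2,
    integral_sub i1 i0, eq3, sub_self]

end Lines

/-! ### From the cone condition to finitely many balls of directions. -/

section Geometry

/-- With `c = cos (κ / 2) ≥ 0`, the cosine of the angle is at least `(ρ/2 - δ) / (ρ/2 + δ)`. This is
at least `c` as soon as `(1 + c) δ ≤ (1 - c) ρ / 2`, which the bound on `δ` guarantees. -/
theorem angle_le_of_mem_closedBall {E : Type*} [NormedAddCommGroup E] [InnerProductSpace ℝ E]
    {ρ κ δ : ℝ} (hρ : 0 < ρ) (hκ : 0 < κ) (hκπ : κ ≤ Real.pi)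
    (hδ : δ ≤ (1 - Real.cos (κ / 2)) * ρ / 4) {v z : E} (hv : ‖v‖ = 1)
    (hz : ‖z - (ρ / 2) • v‖ ≤ δ) :
    ‖z‖ ≤ ρ ∧ InnerProductGeometry.angle z v ≤ κ / 2 := by
  have hc0 : 0 ≤ Real.cos (κ / 2) :=
    Real.cos_nonneg_of_mem_Icc ⟨by linarith, by linarith⟩
  have hc1 : Real.cos (κ / 2) ≤ 1 := Real.cos_le_one _
  set c := Real.cos (κ / 2) with hc
  have hδρ : δ ≤ ρ / 4 := by nlinarith
  have hn : ‖(ρ / 2) • v‖ = ρ / 2 := by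
    rw [norm_smul, hv, Real.norm_of_nonneg (by linarith), mul_one]
  have hzn : ‖z‖ ≤ ρ / 2 + δ := by
    have := norm_add_le (z - (ρ / 2) • v) ((ρ / 2) • v)
    rw [sub_add_cancel, hn] at this
    linarith
  have hin : ρ / 2 - δ ≤ inner ℝ z v := by
    have h1 : inner ℝ z v = inner ℝ (z - (ρ / 2) • v) v + ρ / 2 := by
      rw [inner_sub_left, inner_smul_left, real_inner_self_eq_norm_sq, hv]
      simp
    have h2 := abs_real_inner_le_norm (z - (ρ / 2) • v) v
    rw [hv, mul_one] at h2
    rw [h1]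
    linarith [(abs_le.1 h2).1]
  refine ⟨by linarith, ?_⟩
  have hzpos : 0 < ‖z‖ := by
    have h2 := real_inner_le_norm z v
    rw [hv, mul_one] at h2
    linarith
  have hcos : c ≤ inner ℝ z v / (‖z‖ * ‖v‖) := by
    rw [hv, mul_one, le_div_iff₀ hzpos]
    have hδ0 : 0 ≤ δ := (norm_nonneg _).trans hz
    have h1 : c * ‖z‖ ≤ c * (ρ / 2 + δ) := mul_le_mul_of_nonneg_left hzn hc0
    have h2 : c * δ ≤ δ := mul_le_of_le_one_left hδ0 hc1
    linarith
  calc InnerProductGeometry.angle z v ≤ Real.arccos c := Real.arccos_le_arccos hcos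
    _ = κ / 2 := Real.arccos_cos (by linarith) (by linarith)

/-- The axis direction varies with the point and the domain, but the rescaled axes lie on one
compact sphere. A finite cover by balls of half the admissible radius replaces them by finitely many
directions; the other half of the radius is left for a full ball around each. -/
theorem exists_finset_forall_coneCondition {d : ℕ} {ρ κ : ℝ} (hρ : 0 < ρ) (hκ : 0 < κ)
    (hκπ : κ ≤ Real.pi) :
    ∃ δ : ℝ, 0 < δ ∧ ∃ s : Finset (EuclideanSpace ℝ (Fin d)),
      ∀ Ω : Set (EuclideanSpace ℝ (Fin d)), ConeCondition Ω ρ κ → ∀ x ∈ Ω, ∃ c ∈ s,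
        ∀ z ∈ Metric.closedBall c δ, ∀ t ∈ Set.Icc (0 : ℝ) 1, x + t • z ∈ Ω := by
  have hcos : Real.cos (κ / 2) < 1 := by
    rw [← Real.cos_zero]
    exact Real.cos_lt_cos_of_nonneg_of_le_pi_div_two le_rfl (by linarith) (by linarith)
  set δ := (1 - Real.cos (κ / 2)) * ρ / 4 with hδ
  have hδ0 : 0 < δ := by
    have := mul_pos (sub_pos.2 hcos) hρ
    rw [hδ]; linarith
  obtain ⟨T, -, hT, hcov⟩ := (isCompact_sphere (0 : EuclideanSpace ℝ (Fin d))
    (ρ / 2)).finite_cover_balls (half_pos hδ0)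
  refine ⟨δ / 2, half_pos hδ0, hT.toFinset, fun Ω hΩ x hx => ?_⟩
  obtain ⟨w, hw0, hw⟩ := hΩ x hx
  have hwn : 0 < ‖w‖ := norm_pos_iff.2 hw0
  set v := ‖w‖⁻¹ • w with hv
  have hv1 : ‖v‖ = 1 := by
    rw [hv, norm_smul, norm_inv, norm_norm, inv_mul_cancel₀ hwn.ne']
  have hmem : (ρ / 2) • v ∈ Metric.sphere (0 : EuclideanSpace ℝ (Fin d)) (ρ / 2) := by
    simp only [mem_sphere_zero_iff_norm]
    rw [norm_smul, hv1, Real.norm_of_nonneg (by linarith), mul_one]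
  obtain ⟨c, hcT, hc⟩ := Set.mem_iUnion₂.1 (hcov hmem)
  refine ⟨c, hT.mem_toFinset.2 hcT, fun z hz t ht => hw ?_⟩
  have hzv : ‖z - (ρ / 2) • v‖ ≤ δ := by
    rw [← dist_eq_norm]
    have h1 := Metric.mem_closedBall.1 hz
    have h2 := Metric.mem_ball.1 hc
    rw [dist_comm] at h2
    linarith [dist_triangle z c ((ρ / 2) • v)]
  obtain ⟨hn, ha⟩ := angle_le_of_mem_closedBall hρ hκ hκπ le_rfl hv1 hzv
  rw [hv, InnerProductGeometry.angle_smul_right_of_pos _ _ (inv_pos.2 hwn)] at ha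
  simp only [finiteCone, Set.mem_ofPred_eq, add_sub_cancel_left]
  rcases ht.1.eq_or_lt with h0 | h0
  · left; simp [← h0]
  · right
    rw [InnerProductGeometry.angle_smul_left_of_pos _ _ h0]
    refine ⟨?_, ha⟩
    rw [norm_smul, Real.norm_of_nonneg ht.1]
    nlinarith [ht.2, norm_nonneg z]

/-- A set with nonempty interior spans the space, so a basis can be extracted from it. -/
theorem exists_basis_forall_mem_closedBall {d : ℕ} (c : EuclideanSpace ℝ (Fin d)) {δ : ℝ}
    (hδ : 0 < δ) :
    ∃ b : Module.Basis (Fin d) ℝ (EuclideanSpace ℝ (Fin d)), ∀ i, b i ∈ Metric.closedBall c δ := by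
  obtain ⟨t, ht, hspan, hli⟩ := exists_linearIndependent ℝ (Metric.closedBall c δ)
  have htop : Submodule.span ℝ (Metric.closedBall c δ) = ⊤ := by
    refine Submodule.eq_top_of_nonempty_interior' _ ⟨c, ?_⟩
    exact interior_mono Submodule.subset_span (Metric.ball_subset_interior_closedBall
      (Metric.mem_ball_self hδ))
  let b0 : Module.Basis t ℝ (EuclideanSpace ℝ (Fin d)) :=
    Module.Basis.mk hli (by rw [Subtype.range_coe, hspan, htop])
  let e := b0.indexEquiv (EuclideanSpace.basisFun (Fin d) ℝ).toBasis
  refine ⟨b0.reindex e, fun i => ?_⟩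
  rw [Module.Basis.reindex_apply, Module.Basis.mk_apply]
  exact ht (e.symm i).2

end Geometry

/-! ### A chain rule inequality on lines for locally Lipschitz functions. -/

section ChainRule

/-- A chain rule estimate for an absolutely continuous function on the line. -/
theorem abs_comp_primitive_sub_le {g Φ ψ : ℝ → ℝ}
    (hg : ∀ a b : ℝ, IntervalIntegrable g volume a b) (hΦ : Continuous Φ) (hψ : Continuous ψ)
    (hψ0 : ∀ a, 0 ≤ ψ a)
    (h : ∀ a b, |Φ a - Φ b| ≤ max (ψ a) (ψ b) * |a - b|) (c : ℝ) {t : ℝ} (ht : 0 ≤ t) :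
    |Φ (c + ∫ s in (0 : ℝ)..t, g s) - Φ c| ≤
      ∫ s in (0 : ℝ)..t, ψ (c + ∫ r in (0 : ℝ)..s, g r) * |g s| := by
  set F : ℝ → ℝ := fun t => c + ∫ s in (0 : ℝ)..t, g s with hF
  have hFc : Continuous F := continuous_const.add (intervalIntegral.continuous_primitive hg 0)
  have habs : ∀ a b : ℝ, IntervalIntegrable (fun s => |g s|) volume a b := fun a b => (hg a b).abs
  have hI : ∀ ε a b : ℝ, IntervalIntegrable (fun s => (ψ (F s) + ε) * |g s|) volume a b :=
    fun ε a b => (habs a b).continuousOn_mul (by fun_prop)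
  -- Continuous induction on `y`: the `ε` absorbs the oscillation of `ψ ∘ F` over a short step to
  -- the right, so no differentiability of `Φ` is needed.
  have key : ∀ ε > 0, ∀ y ∈ Set.Icc 0 t,
      |Φ (F y) - Φ c| ≤ ∫ s in (0 : ℝ)..y, (ψ (F s) + ε) * |g s| := by
    intro ε hε
    suffices hsub : Set.Icc 0 t ⊆
        {t | |Φ (F t) - Φ c| ≤ ∫ s in (0 : ℝ)..t, (ψ (F s) + ε) * |g s|} from
      fun y hy => hsub hy
    refine IsClosed.Icc_subset_of_forall_mem_nhdsWithin ?_ ?_ ?_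
    · refine IsClosed.inter (isClosed_le (by fun_prop) ?_) isClosed_Icc
      exact intervalIntegral.continuous_primitive (hI ε) 0
    · simp [hF]
    · rintro x ⟨hx, -⟩
      have hc : ContinuousAt (fun s => ψ (F s)) x := (hψ.comp hFc).continuousAt
      obtain ⟨η, hη, hball⟩ := Metric.continuousAt_iff.1 hc (ε / 2) (half_pos hε)
      refine Filter.mem_of_superset (Ioo_mem_nhdsGT (show x < x + η by linarith)) ?_
      intro y hy
      have hnear : ∀ s ∈ Set.Icc x y, |ψ (F s) - ψ (F x)| < ε / 2 := by
        intro s hs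
        refine hball ?_
        rw [Real.dist_eq, abs_lt]
        constructor <;> linarith [hs.1, hs.2, hy.2]
      have hmax : ∀ s ∈ Set.Icc x y, max (ψ (F y)) (ψ (F x)) ≤ ψ (F s) + ε := by
        intro s hs
        have h1 := abs_lt.1 (hnear s hs)
        have h2 := abs_lt.1 (hnear y ⟨hy.1.le, le_rfl⟩)
        exact max_le (by linarith) (by linarith)
      have hFd : F y - F x = ∫ s in x..y, g s := by
        simp only [hF]
        rw [add_sub_add_left_eq_sub, intervalIntegral.integral_interval_sub_left (hg 0 y) (hg 0 x)]
      have hstep : |Φ (F y) - Φ (F x)| ≤ ∫ s in x..y, (ψ (F s) + ε) * |g s| := by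
        have hm : 0 ≤ max (ψ (F y)) (ψ (F x)) := (hψ0 _).trans (le_max_left _ _)
        calc |Φ (F y) - Φ (F x)| ≤ max (ψ (F y)) (ψ (F x)) * |F y - F x| := h _ _
          _ ≤ max (ψ (F y)) (ψ (F x)) * ∫ s in x..y, |g s| := by
            refine mul_le_mul_of_nonneg_left ?_ hm
            rw [hFd]
            exact intervalIntegral.abs_integral_le_integral_abs hy.1.le
          _ = ∫ s in x..y, max (ψ (F y)) (ψ (F x)) * |g s| := by
            rw [intervalIntegral.integral_const_mul]
          _ ≤ ∫ s in x..y, (ψ (F s) + ε) * |g s| := by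
            refine intervalIntegral.integral_mono_on hy.1.le ((habs x y).const_mul _)
              (hI ε x y) fun s hs => ?_
            exact mul_le_mul_of_nonneg_right (hmax s hs) (abs_nonneg _)
      have hadd := intervalIntegral.integral_add_adjacent_intervals (hI ε 0 x) (hI ε x y)
      simp only [Set.mem_ofPred_eq] at hx ⊢
      rw [← hadd]
      calc |Φ (F y) - Φ c| ≤ |Φ (F x) - Φ c| + |Φ (F y) - Φ (F x)| := by
            rw [add_comm]; exact abs_sub_le _ _ _
        _ ≤ _ := add_le_add hx hstep
  have hlim : ∀ ε > 0, |Φ (F t) - Φ c| ≤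
      (∫ s in (0 : ℝ)..t, ψ (F s) * |g s|) + ε * ∫ s in (0 : ℝ)..t, |g s| := by
    intro ε hε
    refine (key ε hε t ⟨ht, le_rfl⟩).trans_eq ?_
    rw [← intervalIntegral.integral_const_mul, ← intervalIntegral.integral_add]
    · simp only [add_mul]
    · simpa using hI 0 0 t
    · exact (habs 0 t).const_mul ε
  have hT : Filter.Tendsto (fun ε : ℝ => (∫ s in (0 : ℝ)..t, ψ (F s) * |g s|) +
      ε * ∫ s in (0 : ℝ)..t, |g s|) (nhdsWithin 0 (Set.Ioi 0))
      (nhds ((∫ s in (0 : ℝ)..t, ψ (F s) * |g s|) + 0 * ∫ s in (0 : ℝ)..t, |g s|)) :=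
    (Continuous.tendsto (by fun_prop) 0).mono_left nhdsWithin_le_nhds
  rw [zero_mul, add_zero] at hT
  exact ge_of_tendsto hT (Filter.eventually_of_mem self_mem_nhdsWithin hlim)


variable {E : Type*} [NormedAddCommGroup E] [InnerProductSpace ℝ E] [FiniteDimensional ℝ E]
  [MeasurableSpace E] [BorelSpace E]

/-- The exceptional null set of `x` depends on `t`; Fubini exchanges the quantifiers, so that along
almost every segment `u` agrees for almost every `t` with an absolutely continuous function. -/
theorem HasWeakDirDeriv.ae_ae_sub_eq_integral {Ω : Set E} (hΩ : IsOpen Ω) {v : E} {u g : E → ℝ}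
    (hum : Measurable u) (hgm : Measurable g)
    (hu : LocallyIntegrable u) (hg : LocallyIntegrable g) (h : HasWeakDirDeriv Ω v u g) :
    ∀ᵐ x, (∀ s ∈ Set.Icc (0 : ℝ) 1, x + s • v ∈ Ω) → ∀ᵐ t : ℝ, t ∈ Set.Icc (0 : ℝ) 1 →
      u (x + t • v) = u x + ∫ s in (0 : ℝ)..t, g (x + s • v) := by
  have hA := (isOpen_setOf_forall_add_smul_mem hΩ v 0 1).measurableSet
  -- Substitution moves the variable endpoint into the integrand, which makes joint measurability in
  -- `(x, t)` available.
  have hsub : ∀ (x : E) (t : ℝ), ∫ s in (0 : ℝ)..t, g (x + s • v) =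
      t * ∫ s in Set.Ioc (0 : ℝ) 1, g (x + (t * s) • v) := by
    intro x t
    have := intervalIntegral.smul_integral_comp_mul_left (a := 0) (b := 1)
      (fun s => g (x + s • v)) t
    simp only [mul_zero, mul_one, smul_eq_mul] at this
    rw [← this, intervalIntegral.integral_of_le zero_le_one]
  have hm : Measurable fun z : E × ℝ => ∫ s in Set.Ioc (0 : ℝ) 1, g (z.1 + (z.2 * s) • v) := by
    have : StronglyMeasurable (Function.uncurry fun (z : E × ℝ) (s : ℝ) =>
        g (z.1 + (z.2 * s) • v)) := by
      refine Measurable.stronglyMeasurable (hgm.comp ?_)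
      fun_prop
    exact this.integral_prod_right.measurable
  have hset : MeasurableSet {z : E × ℝ | z.1 ∈ {x | ∀ s ∈ Set.Icc (0 : ℝ) 1, x + s • v ∈ Ω} →
      z.2 ∈ Set.Icc (0 : ℝ) 1 →
        u (z.1 + z.2 • v) = u z.1 + ∫ s in (0 : ℝ)..z.2, g (z.1 + s • v)} := by
    simp only [hsub]
    refine MeasurableSet.imp (hA.preimage measurable_fst)
      (MeasurableSet.imp (measurableSet_Icc.preimage measurable_snd) (measurableSet_eq_fun ?_ ?_))
    · exact hum.comp (by fun_prop)
    · exact (hum.comp measurable_fst).add (measurable_snd.mul hm)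
  have key := (Measure.ae_ae_comm (μ := (volume : Measure E)) (ν := (volume : Measure ℝ))
    (p := fun x t => x ∈ {x | ∀ s ∈ Set.Icc (0 : ℝ) 1, x + s • v ∈ Ω} →
      t ∈ Set.Icc (0 : ℝ) 1 →
        u (x + t • v) = u x + ∫ s in (0 : ℝ)..t, g (x + s • v)) hset).2 ?_
  · filter_upwards [key] with x hx hxA
    filter_upwards [hx] with t ht
    exact ht hxA
  · refine Filter.Eventually.of_forall fun t => ?_
    by_cases ht : t ∈ Set.Icc (0 : ℝ) 1
    · filter_upwards [h.ae_sub_eq_integral hΩ hu hg ht.1 ht.2] with x hx hxA _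
      rw [← hx hxA]; ring
    · exact Filter.Eventually.of_forall fun x _ h => absurd h ht

/-- Since `u` need not vanish at the other end of the segment, the chain rule bound is averaged over
the endpoint `t ∈ [0, 1]`; this produces the zero-order term `Φ`. The integrand is nonnegative, so
the integral may be enlarged to the whole line, even though the line may leave `Ω`. -/
theorem HasWeakDirDeriv.ae_ofReal_comp_le_lintegral {Ω : Set E} (hΩ : IsOpen Ω) {v : E}
    {u g : E → ℝ} (hum : Measurable u) (hgm : Measurable g)
    (hu : LocallyIntegrable u) (hg : LocallyIntegrable g) (h : HasWeakDirDeriv Ω v u g)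
    {Φ ψ : ℝ → ℝ} (hΦ : Continuous Φ) (hψ : Continuous ψ) (hΦ0 : ∀ a, 0 ≤ Φ a)
    (hψ0 : ∀ a, 0 ≤ ψ a) (hΦψ : ∀ a b, |Φ a - Φ b| ≤ max (ψ a) (ψ b) * |a - b|) :
    ∀ᵐ x, (∀ s ∈ Set.Icc (0 : ℝ) 1, x + s • v ∈ Ω) →
      ENNReal.ofReal (Φ (u x)) ≤ ∫⁻ s : ℝ,
        ENNReal.ofReal (ψ (u (x + s • v)) * |g (x + s • v)| + Φ (u (x + s • v))) := by
  filter_upwards [h.ae_ae_sub_eq_integral hΩ hum hgm hu hg,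
    ae_forall_intervalIntegrable_line hg v] with x hx hgi hxA
  set F : ℝ → ℝ := fun t => u x + ∫ s in (0 : ℝ)..t, g (x + s • v) with hF
  have hFc : Continuous F := continuous_const.add (intervalIntegral.continuous_primitive hgi 0)
  have hI1 : ∀ a b, IntervalIntegrable (fun s => ψ (F s) * |g (x + s • v)|) volume a b :=
    fun a b => (hgi a b).abs.continuousOn_mul (by fun_prop)
  have hI2 : ∀ a b, IntervalIntegrable (fun s => Φ (F s)) volume a b :=
    fun a b => Continuous.intervalIntegrable (by fun_prop) a b
  have h1 : ∀ t ∈ Set.Icc (0 : ℝ) 1, Φ (u x) ≤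
      Φ (F t) + ∫ s in (0 : ℝ)..1, ψ (F s) * |g (x + s • v)| := by
    intro t ht
    have e1 := abs_comp_primitive_sub_le hgi hΦ hψ hψ0 hΦψ (u x) ht.1
    have e2 : ∫ s in (0 : ℝ)..t, ψ (F s) * |g (x + s • v)| ≤
        ∫ s in (0 : ℝ)..1, ψ (F s) * |g (x + s • v)| := by
      refine intervalIntegral.integral_mono_interval le_rfl ht.1 ht.2
        (Filter.Eventually.of_forall fun s => ?_) (hI1 0 1)
      exact mul_nonneg (hψ0 _) (abs_nonneg _)
    have e3 := (abs_le.1 (e1.trans e2)).1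
    simp only [hF] at *
    linarith
  have h2 : Φ (u x) ≤ ∫ s in (0 : ℝ)..1, (ψ (F s) * |g (x + s • v)| + Φ (F s)) := by
    have e1 := intervalIntegral.integral_mono_on (μ := volume) zero_le_one
      (intervalIntegrable_const (c := Φ (u x))) ((hI2 0 1).add intervalIntegrable_const) h1
    rw [intervalIntegral.integral_add (hI2 0 1) intervalIntegrable_const] at e1
    simp only [intervalIntegral.integral_const, sub_zero, one_smul] at e1
    rw [intervalIntegral.integral_add (hI1 0 1) (hI2 0 1)]
    linarith
  refine (ENNReal.ofReal_le_ofReal h2).trans ?_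
  rw [intervalIntegral.integral_of_le zero_le_one, ofReal_integral_eq_lintegral_ofReal]
  · refine le_trans (le_of_eq (lintegral_congr_ae ?_)) (setLIntegral_le_lintegral (Set.Ioc 0 1) _)
    filter_upwards [ae_restrict_of_ae (hx hxA), ae_restrict_mem measurableSet_Ioc] with s hs hsI
    rw [hs ⟨hsI.1.le, hsI.2⟩]
  · exact ((hI1 0 1).add (hI2 0 1)).1
  · refine Filter.Eventually.of_forall fun s => ?_
    exact add_nonneg (mul_nonneg (hψ0 _) (abs_nonneg _)) (hΦ0 _)

end ChainRule

/-! ### The Loomis–Whitney argument in a general basis. -/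

section GridLines

/-- The Loomis–Whitney type grid-lines inequality with respect to an arbitrary basis. -/
theorem exists_lintegral_rpow_le_of_forall_le_lintegral_line {d : ℕ} (hd : 2 ≤ d)
    (b : Module.Basis (Fin d) ℝ (EuclideanSpace ℝ (Fin d))) :
    ∃ C : ℝ≥0, ∀ (A : Set (EuclideanSpace ℝ (Fin d))), MeasurableSet A →
      ∀ f h : EuclideanSpace ℝ (Fin d) → ℝ≥0∞, Measurable f →
      (∀ i, ∀ᵐ x, x ∈ A → h x ≤ ∫⁻ s : ℝ, f (x + s • b i)) →
      ∫⁻ x in A, h x ^ ((d : ℝ) / (d - 1)) ≤ C * (∫⁻ x, f x) ^ ((d : ℝ) / (d - 1)) := by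
  have hd1 : (0 : ℝ) < d - 1 := by
    have : (2 : ℝ) ≤ d := by exact_mod_cast hd
    linarith
  let T : (Fin d → ℝ) ≃L[ℝ] EuclideanSpace ℝ (Fin d) := b.equivFun.symm.toContinuousLinearEquiv
  have hT : ∀ (y : Fin d → ℝ) (i : Fin d) (s : ℝ),
      T y + s • b i = T (Function.update y i (y i + s)) := by
    intro y i s
    have h1 : Function.update y i (y i + s) = y + s • Pi.single i (1 : ℝ) := by
      ext j
      by_cases hj : j = i
      · subst hj; simp
      · simp [hj]
    have h2 : T (Pi.single i (1 : ℝ)) = b i := by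
      change b.equivFun.symm (Pi.single i (1 : ℝ)) = b i
      rw [LinearEquiv.symm_apply_eq]
      ext j
      simp [Pi.single_apply, eq_comm]
    rw [h1, map_add, map_smul, h2]
  -- In basis coordinates the statement is the standard one on `Fin d → ℝ`; the two Haar measures
  -- differ by the scalars `c` and `c'`.
  have : (Measure.map T (volume : Measure (Fin d → ℝ))).IsAddHaarMeasure :=
    T.isAddHaarMeasure_map volume
  set c : ℝ≥0 := Measure.addHaarScalarFactor (volume : Measure (EuclideanSpace ℝ (Fin d)))
    (Measure.map T (volume : Measure (Fin d → ℝ))) with hc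
  have hvol : (volume : Measure (EuclideanSpace ℝ (Fin d))) =
      c • Measure.map T (volume : Measure (Fin d → ℝ)) :=
    Measure.isAddLeftInvariant_eq_smul _ _
  set c' : ℝ≥0 := Measure.addHaarScalarFactor (Measure.map T (volume : Measure (Fin d → ℝ)))
    (volume : Measure (EuclideanSpace ℝ (Fin d))) with hc'
  have hvol' : Measure.map T (volume : Measure (Fin d → ℝ)) =
      c' • (volume : Measure (EuclideanSpace ℝ (Fin d))) :=
    Measure.isAddLeftInvariant_eq_smul _ _
  have hTm : Measurable T := T.continuous.measurable
  refine ⟨c * c' ^ ((d : ℝ) / (d - 1)), fun A hA f h hf hfh => ?_⟩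
  set R : EuclideanSpace ℝ (Fin d) → ℝ≥0∞ :=
    fun x => ∏ i, (∫⁻ s : ℝ, f (x + s • b i)) ^ ((1 : ℝ) / (d - 1)) with hR
  have hRm : Measurable R := by
    refine Finset.measurable_fun_prod _ fun i _ => Measurable.pow_const ?_ _
    refine Measurable.lintegral_prod_right' (f := fun z : EuclideanSpace ℝ (Fin d) × ℝ =>
      f (z.1 + z.2 • b i)) (hf.comp ?_)
    fun_prop
  have h1 : ∫⁻ x in A, h x ^ ((d : ℝ) / (d - 1)) ≤ ∫⁻ x, R x := by
    refine le_trans (lintegral_mono_ae ?_) (setLIntegral_le_lintegral A R)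
    refine (ae_restrict_iff' hA).2 ?_
    filter_upwards [ae_all_iff.2 hfh] with x hx hxA
    -- The power splits into `d` equal factors, and each is bounded by the line integral in its own
    -- direction.
    calc h x ^ ((d : ℝ) / (d - 1)) = ∏ _i : Fin d, h x ^ ((1 : ℝ) / (d - 1)) := by
          rw [Finset.prod_const, Finset.card_univ, Fintype.card_fin, ← ENNReal.rpow_natCast,
            ← ENNReal.rpow_mul]
          congr 1
          ring
      _ ≤ R x := Finset.prod_le_prod' fun i _ => ENNReal.rpow_le_rpow (hx i hxA) (by positivity)
  have h2 : ∫⁻ y : Fin d → ℝ, R (T y) ≤ (∫⁻ y : Fin d → ℝ, f (T y)) ^ ((d : ℝ) / (d - 1)) := by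
    have hcj : (Fintype.card (Fin d) : ℝ).HolderConjugate ((d : ℝ) / (d - 1)) := by
      rw [Fintype.card_fin]
      exact Real.HolderConjugate.conjExponent (by linarith)
    have := lintegral_prod_lintegral_pow_le (fun _ : Fin d => (volume : Measure ℝ)) hcj
      (f := fun y => f (T y)) (hf.comp hTm)
    refine le_trans (le_of_eq ?_) this
    refine lintegral_congr fun y => ?_
    simp only [hR, Fintype.card_fin]
    refine Finset.prod_congr rfl fun i _ => ?_
    congr 1
    simp only [hT]
    exact lintegral_add_left_eq_self (fun s => f (T (Function.update y i s))) (y i)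
  have h3 : ∫⁻ x, R x = c * ∫⁻ y : Fin d → ℝ, R (T y) := by
    rw [hvol, lintegral_smul_measure, lintegral_map hRm hTm]
    rfl
  have h4 : ∫⁻ y : Fin d → ℝ, f (T y) = c' * ∫⁻ x, f x := by
    rw [← lintegral_map hf hTm, hvol', lintegral_smul_measure]
    rfl
  refine h1.trans ?_
  rw [h3, ENNReal.coe_mul, mul_assoc]
  gcongr
  refine h2.trans_eq ?_
  rw [h4, ENNReal.mul_rpow_of_nonneg _ _ (by positivity), ENNReal.coe_rpow_of_nonneg _
    (by positivity)]

end GridLines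

/-! ### The first-order Sobolev inequality. -/

section FirstOrder

/-- The set of all `x` such that the convex hull of `x` and the ball `closedBall (x + c) δ` is
contained in `Ω`. -/
def coneCore {d : ℕ} (Ω : Set (EuclideanSpace ℝ (Fin d))) (c : EuclideanSpace ℝ (Fin d)) (δ : ℝ) :
    Set (EuclideanSpace ℝ (Fin d)) :=
  {x | ∀ z ∈ Metric.closedBall c δ, ∀ t ∈ Set.Icc (0 : ℝ) 1, x + t • z ∈ Ω}

theorem isOpen_coneCore {d : ℕ} {Ω : Set (EuclideanSpace ℝ (Fin d))} (hΩ : IsOpen Ω)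
    (c : EuclideanSpace ℝ (Fin d)) (δ : ℝ) : IsOpen (coneCore Ω c δ) := by
  have h := isOpen_setOf_forall_add_mem hΩ (((isCompact_closedBall c δ).prod
    (isCompact_Icc (a := (0 : ℝ)) (b := 1))).image (f := fun z => z.2 • z.1) (by fun_prop))
  have heq : coneCore Ω c δ = {x | ∀ y ∈ (fun z : EuclideanSpace ℝ (Fin d) × ℝ => z.2 • z.1) ''
      (Metric.closedBall c δ ×ˢ Set.Icc (0 : ℝ) 1), x + y ∈ Ω} := by
    ext x
    simp only [coneCore, Set.mem_ofPred_eq, Set.forall_mem_image, Set.mem_prod, Prod.forall]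
    exact ⟨fun h z t hz => h z hz.1 t hz.2, fun h z hz t ht => h z t ⟨hz, ht⟩⟩
  rw [heq]
  exact h

/-- This is Bernoulli's inequality at `x / y - 1`, multiplied by `y ^ γ`. -/
theorem rpow_sub_rpow_le {γ x y : ℝ} (hγ : 1 ≤ γ) (hx : 0 ≤ x) (hxy : x ≤ y) :
    y ^ γ - x ^ γ ≤ γ * y ^ (γ - 1) * (y - x) := by
  rcases (hx.trans hxy).eq_or_lt with hy | hy
  · have : x = y := le_antisymm hxy (hy ▸ hx)
    simp [this]
  have h1 := one_add_mul_self_le_rpow_one_add (s := x / y - 1)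
    (by have := div_nonneg hx hy.le; linarith) hγ
  rw [add_sub_cancel, Real.div_rpow hx hy.le, le_div_iff₀ (by positivity)] at h1
  have h2 : y ^ γ = y ^ (γ - 1) * y := by
    conv_rhs => rw [← Real.rpow_one y, ← Real.rpow_mul hy.le, one_mul, ← Real.rpow_add hy]
    congr 1; ring
  have h3 : (1 + γ * (x / y - 1)) * y ^ γ = y ^ γ - γ * y ^ (γ - 1) * (y - x) := by
    rw [h2]; field_simp; ring
  linarith

/-- It supplies the Lipschitz condition of the chain rule for truncated powers. Truncation at `N`
will keep the quantity finite that is to be divided out later. -/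
theorem abs_min_rpow_sub_le {γ N : ℝ} (hγ : 1 ≤ γ) (hN : 0 ≤ N) (a b : ℝ) :
    |min |a| N ^ γ - min |b| N ^ γ| ≤
      max (γ * min |a| N ^ (γ - 1)) (γ * min |b| N ^ (γ - 1)) * |a - b| := by
  have main : ∀ a b : ℝ, min |b| N ≤ min |a| N → |min |a| N ^ γ - min |b| N ^ γ| ≤
      γ * min |a| N ^ (γ - 1) * |a - b| := by
    intro a b hab
    have hb : 0 ≤ min |b| N := le_min (abs_nonneg _) hN
    have ha : 0 ≤ min |a| N := le_min (abs_nonneg _) hN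
    rw [abs_of_nonneg (sub_nonneg.2 (Real.rpow_le_rpow hb hab (by linarith)))]
    refine (rpow_sub_rpow_le hγ hb hab).trans (mul_le_mul_of_nonneg_left ?_ (by positivity))
    have h1 : |a| - |b| ≤ |a - b| := abs_sub_abs_le_abs_sub a b
    rcases le_total |b| N with h | h
    · rw [min_eq_left h]
      exact (sub_le_sub_right (min_le_left _ _) _).trans h1
    · rw [min_eq_right h]
      exact (sub_nonpos.2 (min_le_right _ _)).trans (abs_nonneg _)
  rcases le_total (min |b| N) (min |a| N) with h | h
  · exact (main a b h).trans (mul_le_mul_of_nonneg_right (le_max_left _ _) (abs_nonneg _))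
  · rw [abs_sub_comm, abs_sub_comm a b]
    exact (main b a h).trans (mul_le_mul_of_nonneg_right (le_max_right _ _) (abs_nonneg _))

theorem ofReal_min_abs_rpow {N e : ℝ} (hN : 0 ≤ N) (he : 0 ≤ e) (a : ℝ) :
    ENNReal.ofReal (min |a| N ^ e) = min ‖a‖ₑ (ENNReal.ofReal N) ^ e := by
  rw [← ENNReal.ofReal_rpow_of_nonneg (le_min (abs_nonneg _) hN) he, ENNReal.ofReal_min,
    Real.enorm_eq_ofReal_abs]

theorem hasWeakDirDeriv_sum {d : ℕ} {Ω : Set (EuclideanSpace ℝ (Fin d))}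
    {u : EuclideanSpace ℝ (Fin d) → ℝ} {g : Fin d → EuclideanSpace ℝ (Fin d) → ℝ}
    (hu : LocallyIntegrable u) (hg : ∀ i, LocallyIntegrable (g i))
    (h : ∀ i, HasWeakDirDeriv Ω (EuclideanSpace.single i 1) u (g i))
    (v : EuclideanSpace ℝ (Fin d)) :
    HasWeakDirDeriv Ω v u (fun x => ∑ i, v i * g i x) := by
  intro φ hφ hφc hφΩ
  have hv : ∀ x, fderiv ℝ φ x v = ∑ i, v i * fderiv ℝ φ x (EuclideanSpace.single i 1) := by
    intro x
    conv_lhs => rw [← (EuclideanSpace.basisFun (Fin d) ℝ).sum_repr v]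
    simp
  have hD : ∀ i : Fin d, Integrable fun x => u x * fderiv ℝ φ x (EuclideanSpace.single i 1) := by
    intro i
    have := hu.integrable_smul_left_of_hasCompactSupport
      ((hφ.continuous_fderiv (by simp)).clm_apply continuous_const)
      (hφc.fderiv_apply ℝ (EuclideanSpace.single i 1))
    simpa [mul_comm] using this
  have hG : ∀ i : Fin d, Integrable fun x => g i x * φ x := by
    intro i
    simpa [mul_comm] using (hg i).integrable_smul_left_of_hasCompactSupport hφ.continuous hφc
  calc ∫ x, u x * fderiv ℝ φ x v
      = ∫ x, ∑ i, v i * (u x * fderiv ℝ φ x (EuclideanSpace.single i 1)) := by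
        refine integral_congr_ae (Filter.Eventually.of_forall fun x => ?_)
        simp only [hv, Finset.mul_sum]
        exact Finset.sum_congr rfl fun i _ => by ring
    _ = ∑ i, v i * - ∫ x, g i x * φ x := by
        rw [integral_finsetSum _ fun i _ => (hD i).const_mul _]
        refine Finset.sum_congr rfl fun i _ => ?_
        rw [integral_const_mul, h i φ hφ hφc hφΩ]
    _ = - ∫ x, (∑ i, v i * g i x) * φ x := by
        have : ∀ x, (∑ i, v i * g i x) * φ x = ∑ i, v i * (g i x * φ x) := by
          intro x
          rw [Finset.sum_mul]
          exact Finset.sum_congr rfl fun i _ => by ring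
        simp only [this]
        rw [integral_finsetSum _ fun i _ => (hG i).const_mul _]
        simp [integral_const_mul]

theorem locallyIntegrable_sum_mul {d : ℕ} {g : Fin d → EuclideanSpace ℝ (Fin d) → ℝ}
    (hg : ∀ i, LocallyIntegrable (g i)) (v : EuclideanSpace ℝ (Fin d)) :
    LocallyIntegrable fun x => ∑ i, v i * g i x := by
  rw [locallyIntegrable_iff]
  intro K hK
  exact integrable_finsetSum _ fun i _ => ((hg i).integrableOn_isCompact hK).const_mul _

theorem enorm_sum_mul_le {d : ℕ} (v : EuclideanSpace ℝ (Fin d)) (a : Fin d → ℝ) :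
    ‖∑ i, v i * a i‖ₑ ≤ ‖v‖ₑ * ∑ i, ‖a i‖ₑ := by
  refine (enorm_sum_le _ _).trans ?_
  rw [Finset.mul_sum]
  refine Finset.sum_le_sum fun i _ => ?_
  rw [enorm_mul]
  gcongr
  rw [enorm_le_iff_norm_le]
  exact PiLp.norm_apply_le v i

/-- On `coneCore Ω c δ` every vector of a basis chosen in `closedBall c δ` is an admissible segment,
so the chain rule bound holds in `d` independent directions and the grid-lines inequality applies.
-/
theorem exists_setLIntegral_coneCore_rpow_le {d : ℕ} (hd : 2 ≤ d)
    (c : EuclideanSpace ℝ (Fin d)) {δ : ℝ} (hδ : 0 < δ) {γ : ℝ} (hγ : 1 ≤ γ) :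
    ∃ C : ℝ≥0, ∀ Ω : Set (EuclideanSpace ℝ (Fin d)), IsOpen Ω →
      ∀ (u : EuclideanSpace ℝ (Fin d) → ℝ) (g : Fin d → EuclideanSpace ℝ (Fin d) → ℝ),
      Measurable u → (∀ i, Measurable (g i)) →
      LocallyIntegrable u → (∀ i, LocallyIntegrable (g i)) →
      (∀ i, HasWeakDirDeriv Ω (EuclideanSpace.single i 1) u (g i)) → ∀ N : ℝ, 0 ≤ N →
      ∫⁻ x in coneCore Ω c δ, min ‖u x‖ₑ (ENNReal.ofReal N) ^ (γ * (d / (d - 1))) ≤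
        C * (∫⁻ x, min ‖u x‖ₑ (ENNReal.ofReal N) ^ (γ - 1) * (‖u x‖ₑ + ∑ i, ‖g i x‖ₑ)) ^
          ((d : ℝ) / (d - 1)) := by
  obtain ⟨b, hb⟩ := exists_basis_forall_mem_closedBall c hδ
  obtain ⟨C, hC⟩ := exists_lintegral_rpow_le_of_forall_le_lintegral_line hd b
  have hd1 : (0 : ℝ) < d - 1 := by
    have : (2 : ℝ) ≤ d := by exact_mod_cast hd
    linarith
  -- The product comes from the derivative `γ T ^ (γ - 1)` and the length of the basis vectors, the
  -- `1` from the zero-order term.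
  set M : ℝ≥0 := γ.toNNReal * (‖c‖ + δ).toNNReal + 1 with hM
  refine ⟨C * M ^ ((d : ℝ) / (d - 1)), fun Ω hΩ u g hum hgm hu hg h N hN => ?_⟩
  set T : EuclideanSpace ℝ (Fin d) → ℝ≥0∞ := fun x => min ‖u x‖ₑ (ENNReal.ofReal N) with hT
  have hTm : Measurable T := hum.enorm.min measurable_const
  set G : EuclideanSpace ℝ (Fin d) → ℝ≥0∞ := fun x => ‖u x‖ₑ + ∑ i, ‖g i x‖ₑ with hG
  have hGm : Measurable G :=
    hum.enorm.add (Finset.measurable_fun_sum _ fun i _ => (hgm i).enorm)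
  have key := hC (coneCore Ω c δ) (isOpen_coneCore hΩ c δ).measurableSet
    (fun x => M * (T x ^ (γ - 1) * G x)) (fun x => T x ^ γ)
    (((hTm.pow_const _).mul hGm).const_mul _) ?_
  · simp only [← ENNReal.rpow_mul] at key
    refine key.trans_eq ?_
    rw [lintegral_const_mul _ (f := fun x => T x ^ (γ - 1) * G x) ((hTm.pow_const _).mul hGm),
      ENNReal.mul_rpow_of_nonneg _ _ (by positivity), ENNReal.coe_mul,
      ENNReal.coe_rpow_of_nonneg _ (by positivity), mul_assoc]
  intro i
  have hdir := hasWeakDirDeriv_sum hu hg h (b i)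
  have hbn : ‖b i‖ₑ ≤ ((‖c‖ + δ).toNNReal : ℝ≥0∞) := by
    have h1 : ‖b i‖ ≤ ‖c‖ + δ := by
      have := hb i
      rw [mem_closedBall_iff_norm] at this
      have h2 := norm_add_le (b i - c) c
      rw [sub_add_cancel] at h2
      linarith
    rw [← ofReal_norm]
    exact ENNReal.ofReal_le_ofReal h1
  filter_upwards [hdir.ae_ofReal_comp_le_lintegral hΩ hum
    (Finset.measurable_fun_sum _ fun j _ => (hgm j).const_mul _) hu
    (locallyIntegrable_sum_mul hg (b i))
    (Φ := fun a => min |a| N ^ γ) (ψ := fun a => γ * min |a| N ^ (γ - 1))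
    ((continuous_abs.min continuous_const).rpow_const fun _ => Or.inr (by linarith))
    (continuous_const.mul
      ((continuous_abs.min continuous_const).rpow_const fun _ => Or.inr (by linarith)))
    (fun a => Real.rpow_nonneg (le_min (abs_nonneg _) hN) _)
    (fun a => mul_nonneg (by linarith) (Real.rpow_nonneg (le_min (abs_nonneg _) hN) _))
    (abs_min_rpow_sub_le hγ hN)] with x hx hxA
  have hx' := hx fun s hs => hxA (b i) (hb i) s hs
  rw [ofReal_min_abs_rpow hN (by linarith)] at hx'
  refine hx'.trans (lintegral_mono fun s => ?_)
  set y := x + s • b i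
  have hy0 : 0 ≤ min |u y| N := le_min (abs_nonneg _) hN
  rw [ENNReal.ofReal_add (by positivity) (by positivity), ENNReal.ofReal_mul (by positivity),
    ENNReal.ofReal_mul (by linarith), ofReal_min_abs_rpow hN (by linarith),
    ofReal_min_abs_rpow hN (by linarith), ← Real.enorm_eq_ofReal_abs]
  have e1 : T y ^ γ ≤ T y ^ (γ - 1) * ‖u y‖ₑ := by
    calc T y ^ γ = T y ^ (γ - 1) * T y ^ (1 : ℝ) := by
          rw [← ENNReal.rpow_add_of_nonneg _ _ (by linarith) zero_le_one]
          congr 1; ring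
      _ ≤ _ := by
        rw [ENNReal.rpow_one]
        gcongr
        exact min_le_left _ _
  have e2 := (enorm_sum_mul_le (b i) fun j => g j y).trans (mul_le_mul_left hbn _)
  calc ENNReal.ofReal γ * T y ^ (γ - 1) * ‖∑ j, b i j * g j y‖ₑ + T y ^ γ
      ≤ ENNReal.ofReal γ * T y ^ (γ - 1) * (((‖c‖ + δ).toNNReal : ℝ≥0∞) * G y) +
          T y ^ (γ - 1) * G y := by
        gcongr
        · refine e2.trans ?_
          gcongr
          exact le_add_self
        · refine e1.trans ?_
          gcongr
          exact le_self_add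
    _ = M * (T y ^ (γ - 1) * G y) := by
        rw [hM, ENNReal.ofReal]
        push_cast
        ring

theorem lintegral_le_sum_setLIntegral {α ι : Type*} [MeasurableSpace α] {μ : Measure α}
    {f : α → ℝ≥0∞} (hf : Measurable f) (s : Finset ι) {A : ι → Set α}
    (hA : ∀ i, MeasurableSet (A i)) (h : ∀ x, f x ≠ 0 → ∃ i ∈ s, x ∈ A i) :
    ∫⁻ x, f x ∂μ ≤ ∑ i ∈ s, ∫⁻ x in A i, f x ∂μ := by
  calc ∫⁻ x, f x ∂μ ≤ ∫⁻ x, ∑ i ∈ s, (A i).indicator f x ∂μ := by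
        refine lintegral_mono fun x => ?_
        by_cases hx : f x = 0
        · simp [hx]
        · obtain ⟨i, hi, hxi⟩ := h x hx
          refine le_trans (le_of_eq ?_) (Finset.single_le_sum
            (f := fun i => (A i).indicator f x) (fun _ _ => zero_le) hi)
          simp [hxi]
    _ = _ := by
        rw [lintegral_finsetSum _ fun i _ => hf.indicator (hA i)]
        exact Finset.sum_congr rfl fun i _ => lintegral_indicator (hA i) f

/-- The Sobolev inequality of first order on domains covered by finitely many `coneCore`s. -/
theorem exists_lintegral_rpow_le_first_order {d : ℕ} (hd : 2 ≤ d) {p : ℝ} (hp : 1 ≤ p)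
    (hpd : p < d) (s : Finset (EuclideanSpace ℝ (Fin d))) {δ : ℝ} (hδ : 0 < δ) :
    ∃ K : ℝ≥0, ∀ Ω : Set (EuclideanSpace ℝ (Fin d)), IsOpen Ω →
      (∀ x ∈ Ω, ∃ c ∈ s, x ∈ coneCore Ω c δ) →
      ∀ (u : EuclideanSpace ℝ (Fin d) → ℝ) (g : Fin d → EuclideanSpace ℝ (Fin d) → ℝ),
      Measurable u → (∀ i, Measurable (g i)) →
      LocallyIntegrable u → (∀ i, LocallyIntegrable (g i)) →
      (∀ i, HasWeakDirDeriv Ω (EuclideanSpace.single i 1) u (g i)) →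
      (∀ x ∉ Ω, u x = 0) → ∫⁻ x, ‖u x‖ₑ ^ p ≠ ⊤ →
      (∫⁻ x, ‖u x‖ₑ ^ (d * p / (d - p))) ^ (1 / (d * p / (d - p))) ≤
        K * (∫⁻ x, (‖u x‖ₑ + ∑ i, ‖g i x‖ₑ) ^ p) ^ (1 / p) := by
  have hd2 : (2 : ℝ) ≤ d := by exact_mod_cast hd
  have hd1 : (0 : ℝ) < d - 1 := by linarith
  have hp0 : 0 < p := by linarith
  have hdp : 0 < d - p := by linarith
  set r : ℝ := d * p / (d - p) with hr
  -- This exponent makes the left side the `r`-th power with `r = dp/(d-p)`, while `γ - 1 = r (1 -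
  -- 1/p)`: Hölder then gives back a power of the same integral `X`.
  set γ : ℝ := p * (d - 1) / (d - p) with hγdef
  have hr0 : 0 < r := by positivity
  have hpr : p ≤ r := by
    rw [hr, le_div_iff₀ hdp]; nlinarith
  have hγ : 1 ≤ γ := by
    rw [hγdef, le_div_iff₀ hdp]; nlinarith
  have hγr : γ * (d / (d - 1)) = r := by
    rw [hγdef, hr]; field_simp
  have hγr' : γ - 1 = r * (1 - 1 / p) := by
    rw [hγdef, hr]; field_simp; ring
  have hrinv : 1 / r = (d - 1) / d - (1 - 1 / p) := by
    rw [hr]; field_simp; ring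
  have hp' : 0 ≤ 1 - 1 / p := by
    rw [sub_nonneg, div_le_one hp0]; exact hp
  choose C hC using fun c => exists_setLIntegral_coneCore_rpow_le hd c hδ hγ
  refine ⟨(∑ c ∈ s, C c) ^ (((d : ℝ) - 1) / d), fun Ω hΩ hcov u g hum hgm hu hg h h0 hfin => ?_⟩
  set G : EuclideanSpace ℝ (Fin d) → ℝ≥0∞ := fun x => ‖u x‖ₑ + ∑ i, ‖g i x‖ₑ with hG
  have hGm : Measurable G :=
    hum.enorm.add (Finset.measurable_fun_sum _ fun i _ => (hgm i).enorm)
  have main : ∀ N : ℕ, (∫⁻ x, min ‖u x‖ₑ (N : ℝ≥0∞) ^ r) ^ (1 / r) ≤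
      ((∑ c ∈ s, C c) ^ (((d : ℝ) - 1) / d) : ℝ≥0) * (∫⁻ x, G x ^ p) ^ (1 / p) := by
    intro N
    set T : EuclideanSpace ℝ (Fin d) → ℝ≥0∞ := fun x => min ‖u x‖ₑ (N : ℝ≥0∞) with hT
    have hTm : Measurable T := hum.enorm.min measurable_const
    set X : ℝ≥0∞ := ∫⁻ x, T x ^ r with hX
    set Y : ℝ≥0∞ := (∫⁻ x, G x ^ p) ^ (1 / p) with hY
    -- The truncation and `u ∈ L_p` give finiteness, without which `X ^ (1 - 1 / p)` could not be
    -- cancelled.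
    have hXtop : X ≠ ⊤ := by
      have hle : X ≤ ∫⁻ x, (N : ℝ≥0∞) ^ (r - p) * ‖u x‖ₑ ^ p := by
        refine lintegral_mono fun x => ?_
        calc T x ^ r = T x ^ (r - p) * T x ^ p := by
              rw [← ENNReal.rpow_add_of_nonneg _ _ (by linarith) hp0.le, sub_add_cancel]
          _ ≤ _ := by
              gcongr
              · exact min_le_right _ _
              · exact min_le_left _ _
      refine ne_top_of_le_ne_top ?_ hle
      rw [lintegral_const_mul _ (hum.enorm.pow_const p)]
      exact ENNReal.mul_ne_top (ENNReal.rpow_ne_top_of_nonneg (by linarith)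
        (ENNReal.natCast_ne_top N)) hfin
    have hmain : X ≤ ((∑ c ∈ s, C c : ℝ≥0) : ℝ≥0∞) *
        (X ^ (1 - 1 / p) * Y) ^ ((d : ℝ) / (d - 1)) := by
      have e1 : X ≤ ∑ c ∈ s, ∫⁻ x in coneCore Ω c δ, T x ^ r := by
        refine lintegral_le_sum_setLIntegral (hTm.pow_const r) s
          (fun c => (isOpen_coneCore hΩ c δ).measurableSet) fun x hx => hcov x ?_
        by_contra hxΩ
        apply hx
        simp [hT, h0 x hxΩ, hr0]
      have e2 : ∫⁻ x, T x ^ (γ - 1) * G x ≤ X ^ (1 - 1 / p) * Y := by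
        have := ENNReal.lintegral_mul_norm_pow_le (μ := volume) (f := fun x => T x ^ r)
          (g := fun x => G x ^ p) (hTm.pow_const r).aemeasurable (hGm.pow_const p).aemeasurable
          hp' (show 0 ≤ 1 / p by positivity) (by ring)
        simp only [← ENNReal.rpow_mul, ← hγr', mul_one_div_cancel hp0.ne', ENNReal.rpow_one] at this
        exact this
      refine e1.trans ?_
      push_cast
      rw [Finset.sum_mul]
      refine Finset.sum_le_sum fun c _ => ?_
      have e3 := hC c Ω hΩ u g hum hgm hu hg h N (Nat.cast_nonneg N)
      rw [hγr, ENNReal.ofReal_natCast] at e3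
      refine e3.trans ?_
      gcongr
    rcases eq_or_ne X 0 with hX0 | hX0
    · rw [hX0, ENNReal.zero_rpow_of_pos (by positivity)]
      exact zero_le
    have h2 : X ^ (((d : ℝ) - 1) / d) ≤
        (((∑ c ∈ s, C c) ^ (((d : ℝ) - 1) / d) : ℝ≥0) : ℝ≥0∞) * (X ^ (1 - 1 / p) * Y) := by
      have e := ENNReal.rpow_le_rpow hmain (show 0 ≤ ((d : ℝ) - 1) / d by positivity)
      rw [ENNReal.mul_rpow_of_nonneg _ _ (by positivity), ← ENNReal.rpow_mul,
        show (d : ℝ) / (d - 1) * ((d - 1) / d) = 1 by field_simp, ENNReal.rpow_one,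
        ← ENNReal.coe_rpow_of_nonneg _ (by positivity)] at e
      exact e
    -- Dividing by `X ^ (1 - 1 / p)` leaves exactly `X ^ (1 / r)`.
    rw [hrinv, ENNReal.rpow_sub _ _ hX0 hXtop]
    have hne0 : X ^ (1 - 1 / p) ≠ 0 := (ENNReal.rpow_pos (pos_iff_ne_zero.2 hX0) hXtop).ne'
    have hnet : X ^ (1 - 1 / p) ≠ ⊤ := ENNReal.rpow_ne_top_of_nonneg hp' hXtop
    rw [ENNReal.div_le_iff hne0 hnet]
    refine h2.trans_eq ?_
    ring
  -- The bound does not depend on `N`, so the truncation is removed by Fatou's lemma.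
  have hlim : ∫⁻ x, ‖u x‖ₑ ^ r ≤ ((((∑ c ∈ s, C c) ^ (((d : ℝ) - 1) / d) : ℝ≥0) : ℝ≥0∞) *
      (∫⁻ x, G x ^ p) ^ (1 / p)) ^ r := by
    have hle : ∀ N : ℕ, ∫⁻ x, min ‖u x‖ₑ (N : ℝ≥0∞) ^ r ≤
        ((((∑ c ∈ s, C c) ^ (((d : ℝ) - 1) / d) : ℝ≥0) : ℝ≥0∞) *
          (∫⁻ x, G x ^ p) ^ (1 / p)) ^ r := by
      intro N
      have := ENNReal.rpow_le_rpow (main N) hr0.le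
      rwa [← ENNReal.rpow_mul, one_div_mul_cancel hr0.ne', ENNReal.rpow_one] at this
    have hsup : ∀ x, ‖u x‖ₑ ^ r =
        Filter.liminf (fun N : ℕ => min ‖u x‖ₑ (N : ℝ≥0∞) ^ r) Filter.atTop := by
      intro x
      refine (Filter.Tendsto.liminf_eq (tendsto_const_nhds.congr' ?_)).symm
      obtain ⟨n, hn⟩ := ENNReal.exists_nat_gt (enorm_ne_top (x := u x))
      filter_upwards [Filter.eventually_ge_atTop n] with N hN
      rw [min_eq_left]
      exact hn.le.trans (by exact_mod_cast hN)
    simp only [hsup]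
    refine (lintegral_liminf_le fun N => (hum.enorm.min measurable_const).pow_const r).trans ?_
    refine (Filter.liminf_le_liminf (Filter.Eventually.of_forall hle)).trans ?_
    simp
  have := ENNReal.rpow_le_rpow hlim (show 0 ≤ 1 / r by positivity)
  rwa [← ENNReal.rpow_mul _ r, mul_one_div_cancel hr0.ne', ENNReal.rpow_one] at this

end FirstOrder

/-! ### Iteration to order `k` in the subcritical case. -/

section HigherOrder

theorem eLpNorm_ofReal_eq {α : Type*} [MeasurableSpace α] {μ : Measure α} {p : ℝ} (hp : 0 < p)
    (f : α → ℝ) : eLpNorm f (ENNReal.ofReal p) μ = (∫⁻ x, ‖f x‖ₑ ^ p ∂μ) ^ (1 / p) := by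
  rw [eLpNorm_eq_lintegral_rpow_enorm_toReal (by simpa using hp) ENNReal.ofReal_ne_top,
    ENNReal.toReal_ofReal hp.le]

theorem lintegral_sum_enorm_rpow_le {α ι : Type*} [MeasurableSpace α] {μ : Measure α} {p : ℝ}
    (hp : 1 ≤ p) (s : Finset ι) {f : ι → α → ℝ} (hf : ∀ i ∈ s, AEStronglyMeasurable (f i) μ) :
    (∫⁻ x, (∑ i ∈ s, ‖f i x‖ₑ) ^ p ∂μ) ^ (1 / p) ≤
      ∑ i ∈ s, eLpNorm (f i) (ENNReal.ofReal p) μ := by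
  have h1 : ∀ x, ∑ i ∈ s, ‖f i x‖ₑ = ‖(∑ i ∈ s, fun x => ‖f i x‖) x‖ₑ := by
    intro x
    rw [Finset.sum_apply, Real.enorm_of_nonneg (Finset.sum_nonneg fun i _ => norm_nonneg _),
      ENNReal.ofReal_sum_of_nonneg fun i _ => norm_nonneg _]
    exact Finset.sum_congr rfl fun i _ => (ofReal_norm _).symm
  simp only [h1]
  rw [← eLpNorm_ofReal_eq (by linarith)]
  refine (eLpNorm_sum_le (fun i hi => (hf i hi).norm) (by simpa using hp)).trans_eq ?_
  exact Finset.sum_congr rfl fun i _ => eLpNorm_norm (f i)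

theorem exists_eLpNorm_le_first_order {d : ℕ} (hd : 2 ≤ d) {p : ℝ} (hp : 1 ≤ p)
    (hpd : p < d) (s : Finset (EuclideanSpace ℝ (Fin d))) {δ : ℝ} (hδ : 0 < δ) :
    ∃ K : ℝ≥0, ∀ Ω : Set (EuclideanSpace ℝ (Fin d)), IsOpen Ω →
      (∀ x ∈ Ω, ∃ c ∈ s, x ∈ coneCore Ω c δ) →
      ∀ (u : EuclideanSpace ℝ (Fin d) → ℝ) (g : Fin d → EuclideanSpace ℝ (Fin d) → ℝ),
      Measurable u → (∀ i, Measurable (g i)) →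
      LocallyIntegrable u → (∀ i, LocallyIntegrable (g i)) →
      (∀ i, HasWeakDirDeriv Ω (EuclideanSpace.single i 1) u (g i)) →
      (∀ x ∉ Ω, u x = 0) → eLpNorm u (ENNReal.ofReal p) volume ≠ ⊤ →
      eLpNorm u (ENNReal.ofReal (d * p / (d - p))) volume ≤
        K * (eLpNorm u (ENNReal.ofReal p) volume +
          ∑ i, eLpNorm (g i) (ENNReal.ofReal p) volume) := by
  have hp0 : 0 < p := by linarith
  have hdp : 0 < d - p := by linarith
  have hd0 : (0 : ℝ) < d := by linarith
  obtain ⟨K, hK⟩ := exists_lintegral_rpow_le_first_order hd hp hpd s hδ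
  refine ⟨K, fun Ω hΩ hcov u g hum hgm hu hg h h0 hfin => ?_⟩
  have hfin' : ∫⁻ x, ‖u x‖ₑ ^ p ≠ ⊤ := by
    intro htop
    apply hfin
    rw [eLpNorm_ofReal_eq hp0, htop, ENNReal.top_rpow_of_pos (by positivity)]
  rw [eLpNorm_ofReal_eq (by positivity)]
  refine (hK Ω hΩ hcov u g hum hgm hu hg h h0 hfin').trans ?_
  gcongr
  have := lintegral_sum_enorm_rpow_le (μ := volume) hp Finset.univ
    (f := fun o : Option (Fin d) => o.elim u g)
    (fun o _ => by
      cases o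
      · exact hum.aestronglyMeasurable
      · exact (hgm _).aestronglyMeasurable)
  simp only [Fintype.sum_option] at this
  exact this

/-- `U α`, `|α| ≤ k`, are the weak derivatives in `L_p` of `U 0` on `Ω`, extended by zero. -/
structure IsWeakJet {d : ℕ} (Ω : Set (EuclideanSpace ℝ (Fin d))) (k : ℕ) (p : ℝ)
    (U : (Fin d → ℕ) → EuclideanSpace ℝ (Fin d) → ℝ) : Prop where
  measurable : ∀ α, ∑ i, α i ≤ k → Measurable (U α)
  eq_zero : ∀ α, ∑ i, α i ≤ k → ∀ x ∉ Ω, U α x = 0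
  memLp : ∀ α, ∑ i, α i ≤ k → MemLp (U α) (ENNReal.ofReal p) volume
  hasWeakDirDeriv : ∀ α i, ∑ i, α i + 1 ≤ k →
    HasWeakDirDeriv Ω (EuclideanSpace.single i 1) (U α) (U (α + Pi.single i 1))

/-- The multi-indices of order at most `k`. -/
def ordLE (d k : ℕ) : Finset (Fin d → ℕ) :=
  (Finset.Icc 0 fun _ => k).filter fun α => ∑ i, α i ≤ k

theorem mem_ordLE {d k : ℕ} {α : Fin d → ℕ} : α ∈ ordLE d k ↔ ∑ i, α i ≤ k := by
  simp only [ordLE, Finset.mem_filter, Finset.mem_Icc, and_iff_right_iff_imp]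
  refine fun h => ⟨fun i => Nat.zero_le _, fun i => ?_⟩
  exact (Finset.single_le_sum (f := α) (fun _ _ => Nat.zero_le _) (Finset.mem_univ i)).trans h

theorem sum_add_single {d : ℕ} (α : Fin d → ℕ) (i : Fin d) :
    ∑ j, (α + Pi.single i 1 : Fin d → ℕ) j = ∑ j, α j + 1 := by
  simp [Finset.sum_add_distrib, Pi.single_apply]

theorem IsWeakJet.locallyIntegrable {d : ℕ} {Ω : Set (EuclideanSpace ℝ (Fin d))} {k : ℕ} {p : ℝ}
    {U : (Fin d → ℕ) → EuclideanSpace ℝ (Fin d) → ℝ} (hU : IsWeakJet Ω k p U) (hp : 1 ≤ p)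
    {α : Fin d → ℕ} (hα : ∑ i, α i ≤ k) : LocallyIntegrable (U α) :=
  (hU.memLp α hα).locallyIntegrable (by simpa using hp)

/-- Each application of the first-order inequality trades one derivative for a step from `dp/(d -
jp)` to `dp/(d - (j+1)p)`. The condition `kp < d` keeps every exponent before the last below `d`. -/
theorem exists_eLpNorm_le_of_isWeakJet {d : ℕ} {p : ℝ} (hp : 1 ≤ p) {k : ℕ}
    (hkp : k * p < d) (s : Finset (EuclideanSpace ℝ (Fin d))) {δ : ℝ} (hδ : 0 < δ) {j : ℕ}
    (hj : j ≤ k) :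
    ∃ K : ℝ≥0, ∀ Ω : Set (EuclideanSpace ℝ (Fin d)), IsOpen Ω →
      (∀ x ∈ Ω, ∃ c ∈ s, x ∈ coneCore Ω c δ) →
      ∀ U, IsWeakJet Ω k p U → ∀ α, ∑ i, α i + j ≤ k →
      eLpNorm (U α) (ENNReal.ofReal (d * p / (d - j * p))) volume ≤
        K * ∑ β ∈ ordLE d k, eLpNorm (U β) (ENNReal.ofReal p) volume := by
  have hp0 : 0 < p := by linarith
  induction j with
  | zero =>
    refine ⟨1, fun Ω hΩ hcov U hU α hα => ?_⟩
    have hd : (0 : ℝ) < d := lt_of_le_of_lt (by positivity) hkp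
    rw [Nat.cast_zero, zero_mul, sub_zero, mul_div_cancel_left₀ _ hd.ne', ENNReal.coe_one, one_mul]
    exact Finset.single_le_sum (f := fun β => eLpNorm (U β) (ENNReal.ofReal p) volume)
      (fun _ _ => zero_le) (mem_ordLE.2 (by simpa using hα))
  | succ j ih =>
    obtain ⟨K, hK⟩ := ih (by omega)
    have hjk : ((j : ℝ) + 1) * p ≤ k * p := by
      have : ((j + 1 : ℕ) : ℝ) ≤ k := by exact_mod_cast hj
      push_cast at this
      gcongr
    have hj1 : ((j : ℝ) + 1) * p < d := hjk.trans_lt hkp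
    have hd0 : (0 : ℝ) < d := lt_of_le_of_lt (by positivity) hj1
    have hjp : 0 ≤ j * p := by positivity
    -- From `p ≥ 1` and `(j + 1) p < d`; dimension one cannot occur here.
    have hd2 : 2 ≤ d := by
      have : (1 : ℝ) < d := by nlinarith
      exact_mod_cast this
    have hdj : 0 < d - j * p := by linarith
    have hp1 : 1 ≤ d * p / (d - j * p) := by
      rw [le_div_iff₀ hdj]; nlinarith
    have hpd : d * p / (d - j * p) < d := by
      rw [div_lt_iff₀ hdj]
      refine mul_lt_mul_of_pos_left ?_ hd0
      linarith
    obtain ⟨K', hK'⟩ := exists_eLpNorm_le_first_order hd2 hp1 hpd s hδ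
    have hexp : d * (d * p / (d - j * p)) / (d - d * p / (d - j * p)) =
        d * p / (d - ((j + 1 : ℕ) : ℝ) * p) := by
      have e : (d : ℝ) - ((j + 1 : ℕ) : ℝ) * p = (d - j * p) - p := by push_cast; ring
      rw [e]
      have hA : 0 < (d - j * p) - p := by linarith
      generalize (d : ℝ) - j * p = A at hA hdj
      have e2 : (d : ℝ) - d * p / A = d * (A - p) / A := by field_simp
      rw [e2]
      field_simp
    refine ⟨K' * (K + ∑ _i : Fin d, K), fun Ω hΩ hcov U hU α hα => ?_⟩
    have hle := hK Ω hΩ hcov U hU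
    have hαi : ∀ i, ∑ l, (α + Pi.single i 1 : Fin d → ℕ) l + j ≤ k := by
      intro i; rw [sum_add_single]; omega
    have hfin : eLpNorm (U α) (ENNReal.ofReal (d * p / (d - j * p))) volume ≠ ⊤ := by
      refine ne_top_of_le_ne_top (ENNReal.mul_ne_top ENNReal.coe_ne_top ?_) (hle α (by omega))
      exact ENNReal.sum_ne_top.2 fun β hβ => (hU.memLp β (mem_ordLE.1 hβ)).eLpNorm_ne_top
    have := hK' Ω hΩ hcov (U α) (fun i => U (α + Pi.single i 1)) (hU.measurable α (by omega))
      (fun i => hU.measurable _ (by have := hαi i; omega)) (hU.locallyIntegrable hp (by omega))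
      (fun i => hU.locallyIntegrable hp (by have := hαi i; omega))
      (fun i => hU.hasWeakDirDeriv α i (by omega)) (hU.eq_zero α (by omega)) hfin
    rw [hexp] at this
    refine this.trans ?_
    rw [ENNReal.coe_mul, mul_assoc]
    gcongr
    push_cast
    rw [add_mul, Finset.sum_mul]
    gcongr with i
    · exact hle α (by omega)
    · exact hle _ (hαi i)

end HigherOrder

/-! ### Finite differences and iterated averages along a direction. -/

section Differences

variable {E : Type*} [NormedAddCommGroup E] [NormedSpace ℝ E]

/-- The `j`-fold iterated average `∫_{[0,1]^j} F (x + (s₁ + ⋯ + s_j) v) ds`. -/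
noncomputable def lineAvg (F : E → ℝ≥0∞) : ℕ → E → E → ℝ≥0∞
  | 0, x, _ => F x
  | j + 1, x, v => ∫⁻ s in Set.Icc (0 : ℝ) 1, lineAvg F j (x + s • v) v

theorem measurable_lineAvg [FiniteDimensional ℝ E] [MeasurableSpace E] [BorelSpace E] {F : E → ℝ≥0∞} (hF : Measurable F) (j : ℕ) :
    Measurable fun z : E × E => lineAvg F j z.1 z.2 := by
  induction j with
  | zero => exact hF.comp measurable_fst
  | succ j ih =>
    refine Measurable.lintegral_prod_right'
      (f := fun w : (E × E) × ℝ => lineAvg F j (w.1.1 + w.2 • w.1.2) w.1.2) ?_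
    exact ih.comp (g := fun z : E × E => lineAvg F j z.1 z.2)
      (f := fun w : (E × E) × ℝ => (w.1.1 + w.2 • w.1.2, w.1.2)) (by fun_prop)

theorem fwdDiff_iter_line_integral (v x : E) (f h : E → ℝ) (j : ℕ)
    (hf : ∀ l ≤ j, f (x + l • v + v) - f (x + l • v) = ∫ s in (0 : ℝ)..1, h (x + l • v + s • v))
    (hh : ∀ l ≤ j, IntervalIntegrable (fun s : ℝ => h (x + l • v + s • v)) volume 0 1) :
    (fwdDiff v)^[j + 1] f x = ∫ s in (0 : ℝ)..1, (fwdDiff v)^[j] h (x + s • v) := by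
  rw [Function.iterate_succ_apply, fwdDiff_iter_eq_sum_shift]
  simp only [fwdDiff_iter_eq_sum_shift]
  have hcomm : ∀ (s : ℝ) (l : ℕ), x + s • v + l • v = x + l • v + s • v := fun s l =>
    add_right_comm _ _ _
  simp only [hcomm, zsmul_eq_mul]
  rw [intervalIntegral.integral_finsetSum]
  · refine Finset.sum_congr rfl fun l hl => ?_
    rw [intervalIntegral.integral_const_mul, ← hf l (by simpa [Nat.lt_succ_iff] using hl)]
    rfl
  · intro l hl
    exact (hh l (by simpa [Nat.lt_succ_iff] using hl)).const_mul _

/-- The binomial expansion of the `k`-th difference is solved for its unshifted term; the remaining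
coefficients are at most `2 ^ k`. -/
theorem enorm_le_sum_add_enorm_fwdDiff_iter (v x : E) (f : E → ℝ) (k : ℕ) :
    ‖f x‖ₑ ≤ 2 ^ k * ∑ l ∈ Finset.range k, ‖f (x + ((l + 1 : ℕ) : ℝ) • v)‖ₑ +
      ‖(fwdDiff v)^[k] f x‖ₑ := by
  have h1 := fwdDiff_iter_eq_sum_shift v f k x
  rw [Finset.sum_range_succ'] at h1
  simp only [Nat.choose_zero_right, Nat.cast_one, mul_one, zero_smul, add_zero, Nat.sub_zero] at h1
  set S := ∑ l ∈ Finset.range k,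
    ((-1 : ℤ) ^ (k - (l + 1)) * (k.choose (l + 1) : ℤ)) • f (x + (l + 1) • v) with hS
  have h2 : ‖f x‖ₑ = ‖((-1 : ℤ) ^ k) • f x‖ₑ := by
    rcases neg_one_pow_eq_or ℤ k with h | h <;> simp [h]
  have h3 : ((-1 : ℤ) ^ k) • f x = (fwdDiff v)^[k] f x - S := by rw [h1]; ring
  rw [h2, h3]
  refine enorm_sub_le.trans ?_
  rw [add_comm]
  gcongr
  refine (enorm_sum_le _ _).trans ?_
  rw [Finset.mul_sum]
  refine Finset.sum_le_sum fun l _ => ?_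
  rw [← Nat.cast_smul_eq_nsmul ℝ, zsmul_eq_mul, enorm_mul]
  gcongr
  push_cast
  rw [enorm_mul, enorm_pow]
  have e1 : ‖(-1 : ℝ)‖ₑ = 1 := by simp
  rw [e1, one_pow, one_mul, Real.enorm_natCast]
  exact_mod_cast Nat.choose_le_two_pow k (l + 1)

end Differences

/-- Each difference is traded for an average over `[0, 1]` of the derivative along `v`, a sum of `d`
partial derivatives with coefficients bounded by `‖v‖`. Differences and averages commute, so the
step can be iterated. -/
theorem IsWeakJet.ae_enorm_fwdDiff_iter_le {d : ℕ} {Ω : Set (EuclideanSpace ℝ (Fin d))}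
    (hΩ : IsOpen Ω) {k : ℕ} {p : ℝ} (hp : 1 ≤ p)
    {U : (Fin d → ℕ) → EuclideanSpace ℝ (Fin d) → ℝ} (hU : IsWeakJet Ω k p U)
    {F : EuclideanSpace ℝ (Fin d) → ℝ≥0∞} (hF : ∀ β, ∑ i, β i ≤ k → ∀ x, ‖U β x‖ₑ ≤ F x)
    (v : EuclideanSpace ℝ (Fin d)) (j : ℕ) :
    ∀ α : Fin d → ℕ, ∑ i, α i + j ≤ k → ∀ᵐ x, (∀ t ∈ Set.Icc (0 : ℝ) j, x + t • v ∈ Ω) →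
      ‖(fwdDiff v)^[j] (U α) x‖ₑ ≤ (d * ‖v‖ₑ) ^ j * lineAvg F j x v := by
  induction j with
  | zero =>
    intro α hα
    refine Filter.Eventually.of_forall fun x _ => ?_
    simpa [lineAvg] using hF α (by simpa using hα) x
  | succ j ih =>
    intro α hα
    have hα0 : ∑ i, α i ≤ k := by omega
    have hαi : ∀ i, ∑ l, (α + Pi.single i 1 : Fin d → ℕ) l + j ≤ k := by
      intro i; rw [sum_add_single]; omega
    have hαi0 : ∀ i, ∑ l, (α + Pi.single i 1 : Fin d → ℕ) l ≤ k := fun i => by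
      have := hαi i; omega
    set h : EuclideanSpace ℝ (Fin d) → ℝ := fun x => ∑ i, v i * U (α + Pi.single i 1) x with hh
    have hdir : HasWeakDirDeriv Ω v (U α) h := hasWeakDirDeriv_sum (hU.locallyIntegrable hp hα0)
      (fun i => hU.locallyIntegrable hp (hαi0 i)) (fun i => hU.hasWeakDirDeriv α i (by omega)) v
    have hhloc : LocallyIntegrable h :=
      locallyIntegrable_sum_mul (fun i => hU.locallyIntegrable hp (hαi0 i)) v
    -- The iterated difference samples the integer translates `x + l • v`, so the exceptional sets
    -- must be avoided at all of them at once.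
    have hshift : ∀ {P : EuclideanSpace ℝ (Fin d) → Prop}, (∀ᵐ x, P x) →
        ∀ᵐ x, ∀ l : ℕ, P (x + l • v) := by
      intro P hP
      exact ae_all_iff.2 fun l =>
        (measurePreserving_add_right volume (l • v)).quasiMeasurePreserving.ae hP
    have h1 := hshift (hdir.ae_sub_eq_integral hΩ (hU.locallyIntegrable hp hα0) hhloc
      zero_le_one le_rfl)
    have h2 := hshift (ae_forall_intervalIntegrable_line hhloc v)
    have h3 := ae_all_iff.2 fun i => ae_ae_add_smul (ih (α + Pi.single i 1) (hαi i)) v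
      (volume.restrict (Set.Icc (0 : ℝ) 1))
    filter_upwards [h1, h2, h3] with x hx1 hx2 hx3 hxΩ
    have hrep := fwdDiff_iter_line_integral v x (U α) h j
      (fun l hl => by
        have := hx1 l fun s hs => by
          have := hxΩ (l + s) ⟨by have := hs.1; positivity, by
            push_cast
            have : (l : ℝ) ≤ j := by exact_mod_cast hl
            linarith [hs.2]⟩
          rwa [add_smul, Nat.cast_smul_eq_nsmul, ← add_assoc] at this
        rwa [one_smul] at this)
      (fun l _ => hx2 l 0 1)
    have hlin : ∀ y, (fwdDiff v)^[j] h y =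
        ∑ i, v i * (fwdDiff v)^[j] (U (α + Pi.single i 1)) y := by
      intro y
      have : h = ∑ i, v i • U (α + Pi.single i 1) := by
        ext y; simp [hh]
      rw [this, fwdDiff_iter_finsetSum]
      simp
    rw [hrep, intervalIntegral.integral_of_le zero_le_one]
    refine (enorm_integral_le_lintegral_enorm _).trans ?_
    rw [lineAvg, ← lintegral_const_mul' _ _ (by finiteness)]
    refine (lintegral_mono' (Measure.restrict_mono_set _ Set.Ioc_subset_Icc_self)
      le_rfl).trans (lintegral_mono_ae ?_)
    filter_upwards [ae_all_iff.2 hx3, ae_restrict_mem measurableSet_Icc] with s hs hsI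
    rw [hlin]
    refine (enorm_sum_mul_le v _).trans ?_
    calc ‖v‖ₑ * ∑ i, ‖(fwdDiff v)^[j] (U (α + Pi.single i 1)) (x + s • v)‖ₑ
        ≤ ‖v‖ₑ * ∑ _i : Fin d, ((d * ‖v‖ₑ) ^ j * lineAvg F j (x + s • v) v) := by
          gcongr with i
          refine hs i fun t ht => ?_
          have := hxΩ (s + t) ⟨add_nonneg hsI.1 ht.1, by push_cast; linarith [hsI.2, ht.2]⟩
          rwa [add_smul, ← add_assoc] at this
      _ = (d * ‖v‖ₑ) ^ (j + 1) * lineAvg F j (x + s • v) v := by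
          rw [Finset.sum_const, Finset.card_univ, Fintype.card_fin, nsmul_eq_mul]
          ring

/-! ### Averages over a ball of directions. -/

section Averages

theorem lintegral_comp_add_smul {d : ℕ} {f : EuclideanSpace ℝ (Fin d) → ℝ≥0∞} (hf : Measurable f)
    (x : EuclideanSpace ℝ (Fin d)) {σ : ℝ} (hσ : 0 < σ) :
    ∫⁻ v, f (x + σ • v) = ENNReal.ofReal σ ^ (-(d : ℝ)) * ∫⁻ y, f y := by
  have h1 : ∫⁻ v, f (x + σ • v) =
      ∫⁻ y, f (x + y) ∂(Measure.map (fun v => σ • v) (volume : Measure (EuclideanSpace ℝ (Fin d)))) :=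
    (lintegral_map (f := fun y => f (x + y)) (hf.comp (measurable_const_add x))
      (measurable_const_smul σ)).symm
  rw [h1, Measure.map_addHaar_smul _ hσ.ne', lintegral_smul_measure, finrank_euclideanSpace_fin,
    lintegral_add_left_eq_self f x, smul_eq_mul, abs_of_pos (by positivity),
    ENNReal.ofReal_inv_of_pos (by positivity), ENNReal.ofReal_pow hσ.le, ENNReal.rpow_neg,
    ENNReal.rpow_natCast]

/-- Hölder on `B`, followed by the change of variables `y = x + σ • v`, which costs `σ ^ (-d)` under
the `p`-th root. -/
theorem setLIntegral_comp_add_smul_le {d : ℕ} {f : EuclideanSpace ℝ (Fin d) → ℝ≥0∞}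
    (hf : Measurable f) {p : ℝ} (hp : 1 ≤ p) (B : Set (EuclideanSpace ℝ (Fin d)))
    (x : EuclideanSpace ℝ (Fin d)) {σ : ℝ} (hσ : 0 < σ) :
    ∫⁻ v in B, f (x + σ • v) ≤ volume B ^ (1 - 1 / p) * (∫⁻ y, f y ^ p) ^ (1 / p) *
      ENNReal.ofReal σ ^ (-(d / p)) := by
  have hp0 : 0 < p := by linarith
  have hp' : 0 ≤ 1 - 1 / p := by rw [sub_nonneg, div_le_one hp0]; exact hp
  have hfm : Measurable fun v => f (x + σ • v) := hf.comp (by fun_prop)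
  have h1 := ENNReal.lintegral_mul_norm_pow_le (μ := volume.restrict B)
    (f := fun _ => (1 : ℝ≥0∞)) (g := fun v => f (x + σ • v) ^ p) aemeasurable_const
    (hfm.pow_const p).aemeasurable hp' (show 0 ≤ 1 / p by positivity) (by ring)
  simp only [ENNReal.one_rpow, one_mul, ← ENNReal.rpow_mul, mul_one_div_cancel hp0.ne',
    ENNReal.rpow_one, lintegral_one, Measure.restrict_apply_univ] at h1
  refine h1.trans ?_
  rw [mul_assoc]
  gcongr
  calc (∫⁻ v in B, f (x + σ • v) ^ p) ^ (1 / p)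
      ≤ (∫⁻ v, f (x + σ • v) ^ p) ^ (1 / p) := by
        gcongr
        exact Measure.restrict_le_self
    _ = _ := by
        rw [lintegral_comp_add_smul (f := fun y => f y ^ p) (hf.pow_const p) x hσ,
          ENNReal.mul_rpow_of_nonneg _ _ (by positivity), ← ENNReal.rpow_mul, mul_comm]
        congr 2
        ring

theorem rpow_neg_add_le {σ s b c : ℝ} (hσ : 0 < σ) (hs : 0 < s) (hb : 0 ≤ b) (hbc : b ≤ c) :
    ENNReal.ofReal (σ + s) ^ (-c) ≤ ENNReal.ofReal σ ^ (-(c - b)) * ENNReal.ofReal s ^ (-b) := by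
  have hpos : 0 < σ + s := by linarith
  calc ENNReal.ofReal (σ + s) ^ (-c)
      = ENNReal.ofReal (σ + s) ^ (-(c - b)) * ENNReal.ofReal (σ + s) ^ (-b) := by
        rw [← ENNReal.rpow_add _ _ (by simpa using hpos) ENNReal.ofReal_ne_top]
        congr 1; ring
    _ ≤ _ := by
        simp only [ENNReal.rpow_neg]
        gcongr <;> linarith

theorem lintegral_Icc_rpow_neg_lt_top {b : ℝ} (hb : b < 1) :
    ∫⁻ s in Set.Icc (0 : ℝ) 1, ENNReal.ofReal s ^ (-b) < ⊤ := by
  have h1 := (intervalIntegral.intervalIntegrable_rpow' (a := 0) (b := 1) (r := -b)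
    (by linarith)).1.lintegral_lt_top
  rw [← restrict_Ioc_eq_restrict_Icc]
  refine lt_of_le_of_lt (le_of_eq ?_) h1
  refine lintegral_congr_ae ?_
  filter_upwards [ae_restrict_mem measurableSet_Ioc] with s hs
  rw [ENNReal.ofReal_rpow_of_pos hs.1]

/-- By Tonelli, the outermost average only shifts the parameter from `σ` to `σ + s`, which allows
induction on `j` with `σ` varying. -/
theorem setLIntegral_lineAvg_succ {d : ℕ} {F : EuclideanSpace ℝ (Fin d) → ℝ≥0∞}
    (hF : Measurable F) (B : Set (EuclideanSpace ℝ (Fin d))) (x : EuclideanSpace ℝ (Fin d))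
    (σ : ℝ) (j : ℕ) :
    ∫⁻ v in B, lineAvg F (j + 1) (x + σ • v) v =
      ∫⁻ s in Set.Ioc (0 : ℝ) 1, ∫⁻ v in B, lineAvg F j (x + (σ + s) • v) v := by
  have hm := measurable_lineAvg hF j
  simp only [lineAvg, restrict_Ioc_eq_restrict_Icc]
  rw [lintegral_lintegral_swap]
  · simp only [add_smul, add_assoc]
  · refine Measurable.aemeasurable ?_
    exact hm.comp (f := fun w : EuclideanSpace ℝ (Fin d) × ℝ => (x + σ • w.1 + w.2 • w.1, w.1))
      (by fun_prop)

/-- Each average lowers the singularity `σ ^ (-(d / p))` by an exponent `b`, at the price of one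
factor `∫ s ^ (-b)`, by splitting a power of `σ + s`. -/
theorem setLIntegral_lineAvg_le {d : ℕ} {F : EuclideanSpace ℝ (Fin d) → ℝ≥0∞}
    (hF : Measurable F) {p : ℝ} (hp : 1 ≤ p) (B : Set (EuclideanSpace ℝ (Fin d)))
    (x : EuclideanSpace ℝ (Fin d)) {b : ℝ} (hb : 0 ≤ b) (j : ℕ) :
    j * b ≤ d / p → ∀ σ : ℝ, 0 < σ →
    ∫⁻ v in B, lineAvg F j (x + σ • v) v ≤
      volume B ^ (1 - 1 / p) * (∫⁻ y, F y ^ p) ^ (1 / p) *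
        (∫⁻ s in Set.Icc (0 : ℝ) 1, ENNReal.ofReal s ^ (-b)) ^ j *
          ENNReal.ofReal σ ^ (-(d / p - j * b)) := by
  induction j with
  | zero =>
    intro _ σ hσ
    simpa [lineAvg] using setLIntegral_comp_add_smul_le hF hp B x hσ
  | succ j ih =>
    intro hj σ hσ
    push_cast at hj
    have hj' : j * b ≤ d / p := by linarith
    set A := volume B ^ (1 - 1 / p) * (∫⁻ y, F y ^ p) ^ (1 / p)
    set I := ∫⁻ s in Set.Icc (0 : ℝ) 1, ENNReal.ofReal s ^ (-b) with hI
    rw [setLIntegral_lineAvg_succ hF]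
    calc ∫⁻ s in Set.Ioc (0 : ℝ) 1, ∫⁻ v in B, lineAvg F j (x + (σ + s) • v) v
        ≤ ∫⁻ s in Set.Ioc (0 : ℝ) 1, A * I ^ j * (ENNReal.ofReal σ ^ (-(d / p - j * b - b)) *
            ENNReal.ofReal s ^ (-b)) := by
          refine lintegral_mono_ae ?_
          filter_upwards [ae_restrict_mem measurableSet_Ioc] with s hs
          refine (ih hj' (σ + s) (by linarith [hs.1])).trans ?_
          gcongr
          exact rpow_neg_add_le hσ hs.1 hb (by linarith)
      _ = A * I ^ (j + 1) * ENNReal.ofReal σ ^ (-(d / p - ((j + 1 : ℕ) : ℝ) * b)) := by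
          have hm : Measurable fun s : ℝ => ENNReal.ofReal s ^ (-b) :=
            ENNReal.measurable_ofReal.pow_const _
          rw [lintegral_const_mul _ (hm.const_mul _), lintegral_const_mul _ hm,
            restrict_Ioc_eq_restrict_Icc, ← hI,
            show (d : ℝ) / p - ((j + 1 : ℕ) : ℝ) * b = d / p - j * b - b by push_cast; ring]
          ring

/-- With `b = d / (p k)` the singularity is spread evenly over the `k` averages: after `k - 1` of
them `σ ^ (-b)` remains, and the last one integrates it down to the vertex `σ = 0`. The integrals
are finite when `d < kp`, since then `b < 1`. -/
theorem setLIntegral_lineAvg_vertex_le {d : ℕ} {F : EuclideanSpace ℝ (Fin d) → ℝ≥0∞}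
    (hF : Measurable F) {p : ℝ} (hp : 1 ≤ p) (B : Set (EuclideanSpace ℝ (Fin d)))
    (x : EuclideanSpace ℝ (Fin d)) {k : ℕ} (hk : 1 ≤ k) :
    ∫⁻ v in B, lineAvg F k x v ≤
      volume B ^ (1 - 1 / p) * (∫⁻ y, F y ^ p) ^ (1 / p) *
        (∫⁻ s in Set.Icc (0 : ℝ) 1, ENNReal.ofReal s ^ (-(d / p / k))) ^ k := by
  obtain ⟨j, rfl⟩ := Nat.exists_eq_add_of_le' hk
  set b : ℝ := d / p / ((j + 1 : ℕ) : ℝ) with hb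
  have hp0 : 0 < p := by linarith
  have hb0 : 0 ≤ b := by positivity
  have hjb : d / p - j * b = b := by
    rw [hb]; push_cast; field_simp; ring
  set A := volume B ^ (1 - 1 / p) * (∫⁻ y, F y ^ p) ^ (1 / p)
  set I := ∫⁻ s in Set.Icc (0 : ℝ) 1, ENNReal.ofReal s ^ (-b) with hI
  have h0 := setLIntegral_lineAvg_succ hF B x 0 j
  simp only [zero_smul, add_zero, zero_add] at h0
  rw [h0]
  calc ∫⁻ s in Set.Ioc (0 : ℝ) 1, ∫⁻ v in B, lineAvg F j (x + s • v) v
      ≤ ∫⁻ s in Set.Ioc (0 : ℝ) 1, A * I ^ j * ENNReal.ofReal s ^ (-b) := by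
        refine lintegral_mono_ae ?_
        filter_upwards [ae_restrict_mem measurableSet_Ioc] with s hs
        have := setLIntegral_lineAvg_le hF hp B x hb0 j (by linarith) s hs.1
        rwa [hjb] at this
    _ = A * I ^ (j + 1) := by
        rw [lintegral_const_mul _ (ENNReal.measurable_ofReal.pow_const _),
          restrict_Ioc_eq_restrict_Icc, ← hI]
        ring

end Averages

/-! ### The `L_∞` bound for `kp > d`. -/

section Supercritical

theorem volume_closedBall_smul {d : ℕ} (c : EuclideanSpace ℝ (Fin d)) {r δ : ℝ} (hr : 0 < r)
    (hδ : 0 ≤ δ) :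
    volume (Metric.closedBall c (r * δ)) =
      ENNReal.ofReal r ^ (d : ℝ) * volume (Metric.closedBall (0 : EuclideanSpace ℝ (Fin d)) δ) := by
  rw [Measure.addHaar_closedBall _ _ (by positivity), Measure.addHaar_closedBall _ _ hδ,
    finrank_euclideanSpace_fin, mul_pow, ENNReal.ofReal_mul (by positivity), mul_assoc,
    ENNReal.rpow_natCast, ENNReal.ofReal_pow hr.le]

/-- The ball is scaled by `r / k` so that `k` steps of length `v` remain inside the segment
condition. The difference estimate holds for each `v` at almost every `x`, and Fubini exchanges the
quantifiers so that it can be averaged over `v`. -/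
theorem IsWeakJet.ae_ae_enorm_le {d : ℕ} {Ω : Set (EuclideanSpace ℝ (Fin d))}
    (hΩ : IsOpen Ω) {k : ℕ} (hk : 1 ≤ k) {p : ℝ} (hp : 1 ≤ p)
    {U : (Fin d → ℕ) → EuclideanSpace ℝ (Fin d) → ℝ} (hU : IsWeakJet Ω k p U)
    {F : EuclideanSpace ℝ (Fin d) → ℝ≥0∞} (hFm : Measurable F)
    (hF : ∀ β, ∑ i, β i ≤ k → ∀ x, ‖U β x‖ₑ ≤ F x)
    (c : EuclideanSpace ℝ (Fin d)) {δ r : ℝ} (hr : 0 < r) (hr1 : r ≤ 1) :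
    ∀ᵐ x, x ∈ coneCore Ω c δ →
      ∀ᵐ v, v ∈ Metric.closedBall ((r / k) • c) (r / k * δ) →
        ‖U 0 x‖ₑ ≤ 2 ^ k * ∑ l ∈ Finset.range k, ‖U 0 (x + ((l + 1 : ℕ) : ℝ) • v)‖ₑ +
          (d * ‖v‖ₑ) ^ k * lineAvg F k x v := by
  have hk0 : (0 : ℝ) < k := by exact_mod_cast hk
  have hrk : 0 < r / k := by positivity
  have hU0 : Measurable (U 0) := hU.measurable 0 (by simp)
  have hset : MeasurableSet {z : EuclideanSpace ℝ (Fin d) × EuclideanSpace ℝ (Fin d) |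
      z.1 ∈ coneCore Ω c δ → z.2 ∈ Metric.closedBall ((r / k) • c) (r / k * δ) →
        ‖U 0 z.1‖ₑ ≤ 2 ^ k * ∑ l ∈ Finset.range k, ‖U 0 (z.1 + ((l + 1 : ℕ) : ℝ) • z.2)‖ₑ +
          (d * ‖z.2‖ₑ) ^ k * lineAvg F k z.1 z.2} := by
    refine MeasurableSet.imp ((isOpen_coneCore hΩ c δ).measurableSet.preimage measurable_fst)
      (MeasurableSet.imp (measurableSet_closedBall.preimage measurable_snd)
        (measurableSet_le (hU0.comp measurable_fst).enorm ?_))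
    refine ((Finset.measurable_fun_sum _ fun l _ => ?_).const_mul _).add
      (Measurable.mul ?_ (measurable_lineAvg hFm k))
    · exact (hU0.comp (by fun_prop)).enorm
    · exact (measurable_snd.enorm.const_mul _).pow_const k
  have key := (Measure.ae_ae_comm (μ := (volume : Measure (EuclideanSpace ℝ (Fin d))))
    (ν := (volume : Measure (EuclideanSpace ℝ (Fin d))))
    (p := fun x v => x ∈ coneCore Ω c δ → v ∈ Metric.closedBall ((r / k) • c) (r / k * δ) →
        ‖U 0 x‖ₑ ≤ 2 ^ k * ∑ l ∈ Finset.range k, ‖U 0 (x + ((l + 1 : ℕ) : ℝ) • v)‖ₑ +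
          (d * ‖v‖ₑ) ^ k * lineAvg F k x v) hset).2 ?_
  · filter_upwards [key] with x hx hxc
    filter_upwards [hx] with v hv
    exact hv hxc
  refine Filter.Eventually.of_forall fun v => ?_
  filter_upwards [hU.ae_enorm_fwdDiff_iter_le hΩ hp hF v k 0 (by simp)] with x hx hxc hv
  refine (enorm_le_sum_add_enorm_fwdDiff_iter v x (U 0) k).trans ?_
  gcongr
  refine hx fun t ht => ?_
  have hz : (r / k)⁻¹ • v ∈ Metric.closedBall c δ := by
    rw [mem_closedBall_iff_norm] at hv ⊢
    have : (r / k)⁻¹ • v - c = (r / k)⁻¹ • (v - (r / k) • c) := by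
      rw [smul_sub, inv_smul_smul₀ hrk.ne']
    rw [this, norm_smul, norm_inv, Real.norm_of_nonneg hrk.le, inv_mul_le_iff₀ hrk]
    exact hv
  have := hxc _ hz (t * (r / k)) ⟨mul_nonneg ht.1 hrk.le, ?_⟩
  · rwa [mul_smul, smul_inv_smul₀ hrk.ne'] at this
  · calc t * (r / k) ≤ k * (r / k) := mul_le_mul_of_nonneg_right ht.2 hrk.le
      _ = r := by field_simp
      _ ≤ 1 := hr1

/-- Average the pointwise difference estimate over the steps `v`. Dividing the Hölder factor `V ^ (1
- 1 / p)` by the volume `V`, which is of order `r ^ d`, leaves `r ^ (-(d / p))`; the remainder gains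
`r ^ k` from `‖v‖ ^ k`. -/
theorem exists_ae_enorm_le_of_isWeakJet {d : ℕ} {k : ℕ} (hk : 1 ≤ k) {p : ℝ} (hp : 1 ≤ p)
    (hkp : d < k * p) (c : EuclideanSpace ℝ (Fin d)) {δ : ℝ} (hδ : 0 < δ) :
    ∃ C : ℝ≥0, ∀ Ω : Set (EuclideanSpace ℝ (Fin d)), IsOpen Ω → ∀ U, IsWeakJet Ω k p U →
      ∀ r : ℝ, 0 < r → r ≤ 1 → ∀ᵐ x, x ∈ coneCore Ω c δ →
      ‖U 0 x‖ₑ ≤ C * (ENNReal.ofReal r ^ (-(d / p)) * eLpNorm (U 0) (ENNReal.ofReal p) volume +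
        ENNReal.ofReal r ^ (k - d / p) *
          ∑ β ∈ ordLE d k, eLpNorm (U β) (ENNReal.ofReal p) volume) := by
  have hk0 : (0 : ℝ) < k := by exact_mod_cast hk
  have hp0 : 0 < p := by linarith
  have hb1 : d / p / k < 1 := by
    rw [div_div, div_lt_one (by positivity)]; linarith [mul_comm p (k : ℝ)]
  set I := ∫⁻ s in Set.Icc (0 : ℝ) 1, ENNReal.ofReal s ^ (-(d / p / k)) with hI
  have hItop : I ≠ ⊤ := (lintegral_Icc_rpow_neg_lt_top hb1).ne
  set W := volume (Metric.closedBall (0 : EuclideanSpace ℝ (Fin d)) (δ / k)) with hW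
  have hW0 : W ≠ 0 := (Metric.measure_closedBall_pos volume _ (by positivity)).ne'
  have hWtop : W ≠ ⊤ := measure_closedBall_lt_top.ne
  set M : ℝ≥0∞ := d * ENNReal.ofReal (‖c‖ + δ) with hM
  have hMtop : M ≠ ⊤ := by finiteness
  -- The summands account for the `k` shifted values and for the iterated average; `W` is the ball
  -- volume at scale `r = 1`.
  set C : ℝ≥0∞ := W ^ (-(1 / p)) * (2 ^ k * k + M ^ k * I ^ k) with hC
  have hCtop : C ≠ ⊤ := by
    refine ENNReal.mul_ne_top ?_ (by finiteness)
    rw [ENNReal.rpow_neg]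
    exact ENNReal.inv_ne_top.2 (ENNReal.rpow_pos (pos_iff_ne_zero.2 hW0) hWtop).ne'
  refine ⟨C.toNNReal, fun Ω hΩ U hU r hr hr1 => ?_⟩
  rw [ENNReal.coe_toNNReal hCtop]
  have hU0 : Measurable (U 0) := hU.measurable 0 (by simp)
  set F : EuclideanSpace ℝ (Fin d) → ℝ≥0∞ := fun x => ∑ β ∈ ordLE d k, ‖U β x‖ₑ with hF
  have hFm : Measurable F :=
    Finset.measurable_fun_sum _ fun β hβ => (hU.measurable β (mem_ordLE.1 hβ)).enorm
  have hFle : ∀ β, ∑ i, β i ≤ k → ∀ x, ‖U β x‖ₑ ≤ F x := fun β hβ x =>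
    Finset.single_le_sum (f := fun β => ‖U β x‖ₑ) (fun _ _ => zero_le) (mem_ordLE.2 hβ)
  set N := ∑ β ∈ ordLE d k, eLpNorm (U β) (ENNReal.ofReal p) volume with hN
  have hFN : (∫⁻ y, F y ^ p) ^ (1 / p) ≤ N :=
    lintegral_sum_enorm_rpow_le hp _
      fun β hβ => (hU.measurable β (mem_ordLE.1 hβ)).aestronglyMeasurable
  set A := eLpNorm (U 0) (ENNReal.ofReal p) volume with hA
  set B := Metric.closedBall ((r / k) • c) (r / k * δ) with hB
  set V := volume B with hVdef
  have hV : V = ENNReal.ofReal r ^ (d : ℝ) * W := by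
    rw [hVdef, hB, show r / k * δ = r * (δ / k) by ring]
    exact volume_closedBall_smul _ hr (by positivity)
  have hV0 : V ≠ 0 := (Metric.measure_closedBall_pos volume _ (by positivity)).ne'
  have hVtop : V ≠ ⊤ := measure_closedBall_lt_top.ne
  filter_upwards [hU.ae_ae_enorm_le hΩ hk hp hFm hFle c hr hr1] with x hx hxc
  have h1 : ‖U 0 x‖ₑ * V ≤ V ^ (1 - 1 / p) *
      (2 ^ k * (k * A) + (ENNReal.ofReal r * M) ^ k * (N * I ^ k)) := by
    calc ‖U 0 x‖ₑ * V = ∫⁻ _ in B, ‖U 0 x‖ₑ := by rw [setLIntegral_const]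
      _ ≤ ∫⁻ v in B, (2 ^ k * ∑ l ∈ Finset.range k, ‖U 0 (x + ((l + 1 : ℕ) : ℝ) • v)‖ₑ +
          (ENNReal.ofReal r * M) ^ k * lineAvg F k x v) := by
        refine lintegral_mono_ae ((ae_restrict_iff' measurableSet_closedBall).2 ?_)
        filter_upwards [hx hxc] with v hv hvB
        refine (hv hvB).trans (add_le_add le_rfl (mul_le_mul' (pow_le_pow_left' ?_ k) le_rfl))
        have hvn : ‖v‖ ≤ r * (‖c‖ + δ) := by
          rw [mem_closedBall_iff_norm] at hvB
          have e1 := norm_add_le (v - (r / k) • c) ((r / k) • c)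
          rw [sub_add_cancel, norm_smul, Real.norm_of_nonneg (by positivity)] at e1
          have e2 : r / k ≤ r := div_le_self hr.le (by exact_mod_cast hk)
          calc ‖v‖ ≤ r / k * (‖c‖ + δ) := by linarith
            _ ≤ r * (‖c‖ + δ) := by gcongr
        have hvn' : ‖v‖ₑ ≤ ENNReal.ofReal r * ENNReal.ofReal (‖c‖ + δ) := by
          rw [← ENNReal.ofReal_mul hr.le, ← ofReal_norm]
          exact ENNReal.ofReal_le_ofReal hvn
        calc d * ‖v‖ₑ ≤ d * (ENNReal.ofReal r * ENNReal.ofReal (‖c‖ + δ)) := by gcongr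
          _ = ENNReal.ofReal r * M := by rw [hM]; ring
      _ = 2 ^ k * (∑ l ∈ Finset.range k, ∫⁻ v in B, ‖U 0 (x + ((l + 1 : ℕ) : ℝ) • v)‖ₑ) +
          (ENNReal.ofReal r * M) ^ k * ∫⁻ v in B, lineAvg F k x v := by
        have hm1 : ∀ l : ℕ, Measurable fun v => ‖U 0 (x + ((l + 1 : ℕ) : ℝ) • v)‖ₑ :=
          fun l => (hU0.comp (by fun_prop)).enorm
        have hm2 : Measurable fun v => lineAvg F k x v :=
          (measurable_lineAvg hFm k).comp (f := fun v => (x, v)) (by fun_prop)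
        rw [lintegral_add_right _ (hm2.const_mul _), lintegral_const_mul _ hm2,
          lintegral_const_mul _ (Finset.measurable_fun_sum _ fun l _ => hm1 l),
          lintegral_finsetSum _ fun l _ => hm1 l]
      _ ≤ 2 ^ k * (∑ _l ∈ Finset.range k, V ^ (1 - 1 / p) * A) +
          (ENNReal.ofReal r * M) ^ k * (V ^ (1 - 1 / p) * N * I ^ k) := by
        gcongr with l
        · refine (setLIntegral_comp_add_smul_le hU0.enorm hp B x
            (σ := ((l + 1 : ℕ) : ℝ)) (Nat.cast_pos.2 l.succ_pos)).trans ?_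
          rw [← eLpNorm_ofReal_eq hp0, ← hA]
          -- The shift factors satisfy `l + 1 ≥ 1`, so their scaling cost `(l + 1) ^ (-(d / p))` is
          -- at most one.
          refine mul_le_of_le_one_right' ?_
          rw [ENNReal.rpow_neg]
          refine ENNReal.inv_le_one.2 (le_of_eq_of_le (ENNReal.one_rpow _).symm
            (ENNReal.rpow_le_rpow ?_ (by positivity)))
          rw [ENNReal.ofReal_natCast]
          exact_mod_cast Nat.le_add_left 1 l
        · refine (setLIntegral_lineAvg_vertex_le hFm hp B x hk).trans ?_
          gcongr
      _ = _ := by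
        rw [Finset.sum_const, Finset.card_range, nsmul_eq_mul]
        ring
  have h2 : ‖U 0 x‖ₑ ≤ V ^ (-(1 / p)) *
      (2 ^ k * (k * A) + (ENNReal.ofReal r * M) ^ k * (N * I ^ k)) := by
    rw [sub_eq_neg_add, ENNReal.rpow_add _ _ hV0 hVtop, ENNReal.rpow_one] at h1
    have : V ^ (-(1 / p)) * V * (2 ^ k * (k * A) + (ENNReal.ofReal r * M) ^ k * (N * I ^ k)) =
        V ^ (-(1 / p)) * (2 ^ k * (k * A) + (ENNReal.ofReal r * M) ^ k * (N * I ^ k)) * V := by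
      ring
    rw [this] at h1
    exact (ENNReal.mul_le_mul_iff_left hV0 hVtop).1 h1
  have hr0 : ENNReal.ofReal r ≠ 0 := by simpa using hr
  refine h2.trans ?_
  have hVp : V ^ (-(1 / p)) = ENNReal.ofReal r ^ (-(d / p)) * W ^ (-(1 / p)) := by
    rw [hV, ENNReal.mul_rpow_of_ne_top (ENNReal.rpow_ne_top_of_nonneg (by positivity)
      ENNReal.ofReal_ne_top) hWtop, ← ENNReal.rpow_mul]
    congr 2; ring
  have hrk : ENNReal.ofReal r ^ ((k : ℝ) - d / p) =
      ENNReal.ofReal r ^ (-(d / p)) * ENNReal.ofReal r ^ k := by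
    rw [sub_eq_neg_add, ENNReal.rpow_add _ _ hr0 ENNReal.ofReal_ne_top, ENNReal.rpow_natCast]
  rw [hVp, hrk, hC]
  set R := ENNReal.ofReal r ^ (-(d / p))
  set W' := W ^ (-(1 / p))
  calc R * W' * (2 ^ k * (k * A) + (ENNReal.ofReal r * M) ^ k * (N * I ^ k))
      = W' * (2 ^ k * k) * (R * A) + W' * (M ^ k * I ^ k) * (R * ENNReal.ofReal r ^ k * N) := by
        ring
    _ ≤ W' * (2 ^ k * k + M ^ k * I ^ k) * (R * A) +
        W' * (2 ^ k * k + M ^ k * I ^ k) * (R * ENNReal.ofReal r ^ k * N) := by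
        gcongr
        · exact le_self_add
        · exact le_add_self
    _ = _ := by ring

/-- The free scale `r` is chosen to balance the two terms of the local estimate. One of finitely
many centres serves each point, so the sum of the constants suffices. -/
theorem exists_eLpNorm_top_le_of_isWeakJet {d : ℕ} {k : ℕ} (hk : 1 ≤ k) {p : ℝ} (hp : 1 ≤ p)
    (hkp : d < k * p) (s : Finset (EuclideanSpace ℝ (Fin d))) {δ : ℝ} (hδ : 0 < δ) :
    ∃ K : ℝ≥0, ∀ Ω : Set (EuclideanSpace ℝ (Fin d)), IsOpen Ω →
      (∀ x ∈ Ω, ∃ c ∈ s, x ∈ coneCore Ω c δ) → ∀ U, IsWeakJet Ω k p U →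
      eLpNorm (U 0) ⊤ volume ≤ K *
        (∑ β ∈ ordLE d k, eLpNorm (U β) (ENNReal.ofReal p) volume) ^ (d / (k * p)) *
          eLpNorm (U 0) (ENNReal.ofReal p) volume ^ (1 - d / (k * p)) := by
  have hk0 : (0 : ℝ) < k := by exact_mod_cast hk
  have hp0 : 0 < p := by linarith
  choose C hC using fun c => exists_ae_enorm_le_of_isWeakJet hk hp hkp c hδ
  refine ⟨(∑ c ∈ s, C c) * 2, fun Ω hΩ hcov U hU => ?_⟩
  set N := ∑ β ∈ ordLE d k, eLpNorm (U β) (ENNReal.ofReal p) volume with hN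
  set A := eLpNorm (U 0) (ENNReal.ofReal p) volume with hA
  have hU0 : Measurable (U 0) := hU.measurable 0 (by simp)
  have hAN : A ≤ N := Finset.single_le_sum
    (f := fun β => eLpNorm (U β) (ENNReal.ofReal p) volume) (fun _ _ => zero_le)
    (mem_ordLE.2 (by simp))
  have hNtop : N ≠ ⊤ :=
    ENNReal.sum_ne_top.2 fun β hβ => (hU.memLp β (mem_ordLE.1 hβ)).eLpNorm_ne_top
  have hAtop : A ≠ ⊤ := ne_top_of_le_ne_top hNtop hAN
  rcases eq_or_ne A 0 with hA0 | hA0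
  · rw [hA, eLpNorm_eq_zero_iff hU0.aestronglyMeasurable (by simpa using hp0)] at hA0
    rw [eLpNorm_congr_ae hA0]
    simp
  have hN0 : N ≠ 0 := fun h => hA0 (le_antisymm (h ▸ hAN) zero_le)
  have hA' : 0 < A.toReal := ENNReal.toReal_pos hA0 hAtop
  have hN' : 0 < N.toReal := ENNReal.toReal_pos hN0 hNtop
  -- Here `r ^ k N = A`, so both terms equal `N ^ θ A ^ (1 - θ)`; `A ≤ N` makes `r ≤ 1`.
  set r : ℝ := (A.toReal / N.toReal) ^ (1 / (k : ℝ)) with hr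
  have hr0 : 0 < r := by positivity
  have hr1 : r ≤ 1 := by
    refine Real.rpow_le_one (by positivity) ?_ (by positivity)
    rw [div_le_one hN']
    exact ENNReal.toReal_mono hNtop hAN
  have hrE : ENNReal.ofReal r = (A / N) ^ (1 / (k : ℝ)) := by
    rw [hr, ← ENNReal.ofReal_rpow_of_pos (by positivity), ENNReal.ofReal_div_of_pos hN',
      ENNReal.ofReal_toReal hAtop, ENNReal.ofReal_toReal hNtop]
  set θ : ℝ := d / (k * p) with hθ
  have hkey : ∀ e : ℝ, (A / N) ^ e = A ^ e * N ^ (-e) := by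
    intro e
    rw [div_eq_mul_inv, ENNReal.mul_rpow_of_ne_top hAtop (ENNReal.inv_ne_top.2 hN0),
      ENNReal.inv_rpow, ENNReal.rpow_neg]
  have e1 : ENNReal.ofReal r ^ (-(d / p)) * A = N ^ θ * A ^ (1 - θ) := by
    rw [hrE, ← ENNReal.rpow_mul, show 1 / (k : ℝ) * -(d / p) = -θ by rw [hθ]; field_simp,
      hkey, neg_neg]
    have : A ^ (1 - θ) = A ^ (-θ) * A := by
      rw [sub_eq_neg_add, ENNReal.rpow_add _ _ hA0 hAtop, ENNReal.rpow_one]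
    rw [this]; ring
  have e2 : ENNReal.ofReal r ^ (k - d / p) * N = N ^ θ * A ^ (1 - θ) := by
    rw [hrE, ← ENNReal.rpow_mul, show 1 / (k : ℝ) * (k - d / p) = 1 - θ by rw [hθ]; field_simp,
      hkey]
    have : N ^ θ = N ^ (-(1 - θ)) * N := by
      rw [show θ = -(1 - θ) + 1 by ring, ENNReal.rpow_add _ _ hN0 hNtop, ENNReal.rpow_one]
      congr 3; ring
    rw [this]; ring
  rw [eLpNorm_exponent_top]
  refine eLpNormEssSup_le_of_ae_enorm_bound ?_
  filter_upwards [(Finset.eventually_all s).2 fun c _ => hC c Ω hΩ U hU r hr0 hr1] with x hx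
  by_cases hxΩ : x ∈ Ω
  · obtain ⟨c, hc, hxc⟩ := hcov x hxΩ
    refine (hx c hc hxc).trans ?_
    rw [e1, e2, ← two_mul, ENNReal.coe_mul, ENNReal.coe_ofNat, mul_assoc, mul_assoc]
    gcongr
    exact Finset.single_le_sum (f := C) (fun _ _ => zero_le) hc
  · simp [hU.eq_zero 0 (by simp) x hxΩ]

end Supercritical

/-! ### Commuting derivatives of test functions. -/

section TestFunctions

variable {d : ℕ}

theorem contDiff_partialDeriv {φ : EuclideanSpace ℝ (Fin d) → ℝ} (hφ : ContDiff ℝ ∞ φ)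
    (i : Fin d) : ContDiff ℝ ∞ (partialDeriv i φ) :=
  (hφ.fderiv_right (m := ∞) (by simp)).clm_apply contDiff_const

theorem contDiff_partialDeriv_iter {φ : EuclideanSpace ℝ (Fin d) → ℝ} (hφ : ContDiff ℝ ∞ φ)
    (i : Fin d) (n : ℕ) : ContDiff ℝ ∞ ((partialDeriv i)^[n] φ) := by
  induction n with
  | zero => exact hφ
  | succ n ih =>
    rw [Function.iterate_succ_apply']
    exact contDiff_partialDeriv ih i

theorem partialDeriv_comm {φ : EuclideanSpace ℝ (Fin d) → ℝ} (hφ : ContDiff ℝ ∞ φ)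
    (i j : Fin d) : partialDeriv i (partialDeriv j φ) = partialDeriv j (partialDeriv i φ) := by
  have hdiff : Differentiable ℝ (fderiv ℝ φ) :=
    (hφ.fderiv_right (m := ∞) (by simp)).differentiable (by simp)
  have key : ∀ (a b : Fin d) x, partialDeriv a (partialDeriv b φ) x =
      fderiv ℝ (fderiv ℝ φ) x (EuclideanSpace.single a 1) (EuclideanSpace.single b 1) := by
    intro a b x
    change fderiv ℝ (fun y => fderiv ℝ φ y (EuclideanSpace.single b 1)) x _ = _
    rw [fderiv_clm_apply (hdiff x) (differentiableAt_const _)]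
    simp
  ext x
  rw [key, key]
  have hsymm : IsSymmSndFDerivAt ℝ φ x := hφ.contDiffAt.isSymmSndFDerivAt
    (by simpa using (WithTop.coe_le_coe.2 le_top : ((2 : ℕ∞) : WithTop ℕ∞) ≤ (⊤ : ℕ∞)))
  exact hsymm _ _

theorem partialDeriv_iter_comm {φ : EuclideanSpace ℝ (Fin d) → ℝ} (hφ : ContDiff ℝ ∞ φ)
    (i j : Fin d) (n : ℕ) :
    (partialDeriv i)^[n] (partialDeriv j φ) = partialDeriv j ((partialDeriv i)^[n] φ) := by
  induction n with
  | zero => rfl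
  | succ n ih =>
    rw [Function.iterate_succ_apply', Function.iterate_succ_apply', ih,
      partialDeriv_comm (contDiff_partialDeriv_iter hφ i n)]

theorem contDiff_foldr_partialDeriv {φ : EuclideanSpace ℝ (Fin d) → ℝ} (hφ : ContDiff ℝ ∞ φ)
    (α : Fin d → ℕ) (l : List (Fin d)) :
    ContDiff ℝ ∞ (l.foldr (fun i ψ => (partialDeriv i)^[α i] ψ) φ) := by
  induction l with
  | nil => exact hφ
  | cons i l ih => exact contDiff_partialDeriv_iter ih i (α i)

theorem foldr_partialDeriv_comm {φ : EuclideanSpace ℝ (Fin d) → ℝ} (hφ : ContDiff ℝ ∞ φ)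
    (α : Fin d → ℕ) (l : List (Fin d)) (j : Fin d) :
    l.foldr (fun i ψ => (partialDeriv i)^[α i] ψ) (partialDeriv j φ) =
      partialDeriv j (l.foldr (fun i ψ => (partialDeriv i)^[α i] ψ) φ) := by
  induction l with
  | nil => rfl
  | cons i l ih =>
    simp only [List.foldr_cons]
    rw [ih, partialDeriv_iter_comm (contDiff_foldr_partialDeriv hφ α l)]

theorem foldr_partialDeriv_add_single_of_notMem (φ : EuclideanSpace ℝ (Fin d) → ℝ)
    (α : Fin d → ℕ) {l : List (Fin d)} {j : Fin d} (hj : j ∉ l) :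
    l.foldr (fun i ψ => (partialDeriv i)^[(α + Pi.single j 1 : Fin d → ℕ) i] ψ) φ =
      l.foldr (fun i ψ => (partialDeriv i)^[α i] ψ) φ := by
  induction l with
  | nil => rfl
  | cons i l ih =>
    simp only [List.mem_cons, not_or] at hj
    simp only [List.foldr_cons]
    rw [ih hj.2, Pi.add_apply, Pi.single_eq_of_ne (Ne.symm hj.1), add_zero]

theorem foldr_partialDeriv_add_single {φ : EuclideanSpace ℝ (Fin d) → ℝ} (hφ : ContDiff ℝ ∞ φ)
    (α : Fin d → ℕ) {l : List (Fin d)} (hl : l.Nodup) {j : Fin d} (hj : j ∈ l) :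
    l.foldr (fun i ψ => (partialDeriv i)^[(α + Pi.single j 1 : Fin d → ℕ) i] ψ) φ =
      l.foldr (fun i ψ => (partialDeriv i)^[α i] ψ) (partialDeriv j φ) := by
  induction l with
  | nil => simp at hj
  | cons i l ih =>
    rw [List.nodup_cons] at hl
    simp only [List.foldr_cons]
    by_cases hij : j = i
    · subst hij
      rw [foldr_partialDeriv_add_single_of_notMem φ α hl.1, foldr_partialDeriv_comm hφ,
        Pi.add_apply, Pi.single_eq_same, Function.iterate_succ_apply]
    · rw [ih hl.2 ((List.mem_cons.1 hj).resolve_left hij), Pi.add_apply,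
        Pi.single_eq_of_ne (Ne.symm hij), add_zero]

/-- Partial derivatives of smooth functions commute, so the extra one can be moved innermost; this
lets `partialDeriv i φ` serve as a test function for `D^α`. -/
theorem multiDeriv_add_single {φ : EuclideanSpace ℝ (Fin d) → ℝ} (hφ : ContDiff ℝ ∞ φ)
    (α : Fin d → ℕ) (i : Fin d) :
    multiDeriv (α + Pi.single i 1) φ = multiDeriv α (partialDeriv i φ) :=
  foldr_partialDeriv_add_single hφ α (List.nodup_finRange d) (List.mem_finRange i)

theorem multiDeriv_zero (φ : EuclideanSpace ℝ (Fin d) → ℝ) : multiDeriv 0 φ = φ := by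
  unfold multiDeriv
  induction List.finRange d with
  | nil => rfl
  | cons i l ih => simp

end TestFunctions

/-! ### From weak derivatives on `Ω` to jets on the whole space. -/

section WeakDerivatives

variable {d : ℕ} {Ω : Set (EuclideanSpace ℝ (Fin d))}

theorem integrable_mul_of_tsupport_subset {v φ : EuclideanSpace ℝ (Fin d) → ℝ}
    (hv : LocallyIntegrableOn v Ω) (hφ : Continuous φ) (hc : HasCompactSupport φ)
    (hs : tsupport φ ⊆ Ω) : Integrable fun x => v x * φ x := by
  have h1 : IntegrableOn v (tsupport φ) := hv.integrableOn_compact_subset hs hc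
  refine (integrableOn_iff_integrable_of_support_subset ?_).1
    (h1.mul_continuousOn hφ.continuousOn hc)
  exact fun x hx => subset_tsupport φ (right_ne_zero_of_mul hx)

theorem setIntegral_mul_eq_integral (v : EuclideanSpace ℝ (Fin d) → ℝ)
    {φ : EuclideanSpace ℝ (Fin d) → ℝ} (hs : tsupport φ ⊆ Ω) :
    ∫ x in Ω, v x * φ x = ∫ x, v x * φ x := by
  refine setIntegral_eq_integral_of_forall_compl_eq_zero fun x hx => ?_
  rw [image_eq_zero_of_notMem_tsupport fun h => hx (hs h), mul_zero]

/-- Weak derivatives are unique. -/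
theorem HasWeakDeriv.ae_eq (hΩ : IsOpen Ω) {α : Fin d → ℕ}
    {u v w : EuclideanSpace ℝ (Fin d) → ℝ} (hv : HasWeakDeriv Ω α u v)
    (hw : HasWeakDeriv Ω α u w) : v =ᵐ[volume.restrict Ω] w := by
  have key := hΩ.ae_eq_zero_of_integral_contDiff_smul_eq_zero
    (μ := (volume : Measure (EuclideanSpace ℝ (Fin d)))) (f := fun x => v x - w x)
    (hv.2.1.sub hw.2.1) fun φ hφ hc hs => by
      have h1 := (hv.2.2 φ hφ hc hs).symm.trans (hw.2.2 φ hφ hc hs)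
      have h2 := mul_left_cancel₀ (pow_ne_zero _ (by norm_num)) h1
      rw [setIntegral_mul_eq_integral v hs, setIntegral_mul_eq_integral w hs] at h2
      have h3 : ∀ x, φ x • (v x - w x) = v x * φ x - w x * φ x := fun x => by
        simp only [smul_eq_mul]; ring
      simp only [h3]
      rw [integral_sub (integrable_mul_of_tsupport_subset hv.2.1 hφ.continuous hc hs)
        (integrable_mul_of_tsupport_subset hw.2.1 hφ.continuous hc hs), h2, sub_self]
  refine (ae_restrict_iff' hΩ.measurableSet).2 ?_
  filter_upwards [key] with x hx hxΩ
  exact sub_eq_zero.1 (hx hxΩ)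

theorem HasWeakDeriv.weakDeriv {α : Fin d → ℕ} {u v : EuclideanSpace ℝ (Fin d) → ℝ}
    (h : HasWeakDeriv Ω α u v) : HasWeakDeriv Ω α u (weakDeriv Ω α u) := by
  have hex : ∃ v, HasWeakDeriv Ω α u v := ⟨v, h⟩
  rw [AnisoSobolev.weakDeriv, dif_pos hex]
  exact hex.choose_spec

theorem hasWeakDeriv_zero {u : EuclideanSpace ℝ (Fin d) → ℝ} (hu : LocallyIntegrableOn u Ω) :
    HasWeakDeriv Ω 0 u u :=
  ⟨hu, hu, fun φ _ _ _ => by simp [multiDeriv_zero]⟩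

/-- Weak derivatives are defined one by one from `u`. Testing the `α`-identity with `∂ᵢφ` and
cancelling the sign `(-1) ^ |α|` shows that consecutive ones are related by a first-order weak
derivative. -/
theorem HasWeakDeriv.setIntegral_mul_fderiv {α : Fin d → ℕ} {i : Fin d}
    {u v w : EuclideanSpace ℝ (Fin d) → ℝ} (hv : HasWeakDeriv Ω α u v)
    (hw : HasWeakDeriv Ω (α + Pi.single i 1) u w) {φ : EuclideanSpace ℝ (Fin d) → ℝ}
    (hφ : ContDiff ℝ ∞ φ) (hc : HasCompactSupport φ) (hs : tsupport φ ⊆ Ω) :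
    ∫ x in Ω, v x * fderiv ℝ φ x (EuclideanSpace.single i 1) = - ∫ x in Ω, w x * φ x := by
  have h1 := hv.2.2 (partialDeriv i φ) (contDiff_partialDeriv hφ i) (hc.fderiv_apply ℝ _)
    ((tsupport_fderiv_apply_subset ℝ _).trans hs)
  have h2 := hw.2.2 φ hφ hc hs
  rw [multiDeriv_add_single hφ, h1, sum_add_single, pow_succ, mul_assoc] at h2
  have h3 := mul_left_cancel₀ (pow_ne_zero _ (by norm_num)) h2
  rw [neg_one_mul] at h3
  exact h3

/-- A measurable representative of the weak derivative `D^α u`, extended by zero. -/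
noncomputable def jet (Ω : Set (EuclideanSpace ℝ (Fin d))) (u : EuclideanSpace ℝ (Fin d) → ℝ)
    (α : Fin d → ℕ) : EuclideanSpace ℝ (Fin d) → ℝ :=
  open Classical in
  if h : AEStronglyMeasurable (weakDeriv Ω α u) (volume.restrict Ω) then Ω.indicator (h.mk _) else 0

theorem MemSobolev.memLp_weakDeriv (hΩ : IsOpen Ω) {m : Fin d → ℕ} {p : ℝ≥0∞}
    {u : EuclideanSpace ℝ (Fin d) → ℝ} (hu : MemSobolev Ω m p u) {α : Fin d → ℕ}
    (hα : α ∈ dom m) : MemLp (weakDeriv Ω α u) p (volume.restrict Ω) := by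
  obtain ⟨v, hv, hvp⟩ := hu α hα
  exact (memLp_congr_ae (hv.ae_eq hΩ hv.weakDeriv)).1 hvp

theorem jet_ae_eq (hΩ : IsOpen Ω) {u : EuclideanSpace ℝ (Fin d) → ℝ} {α : Fin d → ℕ}
    (h : AEStronglyMeasurable (weakDeriv Ω α u) (volume.restrict Ω)) :
    jet Ω u α =ᵐ[volume.restrict Ω] weakDeriv Ω α u := by
  rw [jet, dif_pos h]
  exact (indicator_ae_eq_restrict hΩ.measurableSet).trans h.ae_eq_mk.symm

theorem measurable_jet (hΩ : IsOpen Ω) (u : EuclideanSpace ℝ (Fin d) → ℝ) (α : Fin d → ℕ) :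
    Measurable (jet Ω u α) := by
  rw [jet]
  split_ifs with h
  · exact h.stronglyMeasurable_mk.measurable.indicator hΩ.measurableSet
  · exact measurable_zero

theorem jet_eq_zero (u : EuclideanSpace ℝ (Fin d) → ℝ) (α : Fin d → ℕ)
    {x : EuclideanSpace ℝ (Fin d)} (hx : x ∉ Ω) : jet Ω u α x = 0 := by
  rw [jet]
  split_ifs with h
  · exact Set.indicator_of_notMem hx _
  · rfl

theorem eLpNorm_jet (hΩ : IsOpen Ω) {u : EuclideanSpace ℝ (Fin d) → ℝ} {α : Fin d → ℕ}
    (h : AEStronglyMeasurable (weakDeriv Ω α u) (volume.restrict Ω)) (p : ℝ≥0∞) :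
    eLpNorm (jet Ω u α) p volume = eLpNorm (weakDeriv Ω α u) p (volume.restrict Ω) := by
  have h0 : jet Ω u α = Ω.indicator (jet Ω u α) := by
    ext x
    by_cases hx : x ∈ Ω
    · rw [Set.indicator_of_mem hx]
    · rw [Set.indicator_of_notMem hx, jet_eq_zero u α hx]
  rw [h0, eLpNorm_indicator_eq_eLpNorm_restrict hΩ.measurableSet,
    eLpNorm_congr_ae (jet_ae_eq hΩ h)]

theorem MemSobolev.isWeakJet (hΩ : IsOpen Ω) {m : Fin d → ℕ} {p : ℝ}
    {u : EuclideanSpace ℝ (Fin d) → ℝ} (hu : MemSobolev Ω m (ENNReal.ofReal p) u) {k : ℕ}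
    (hk : ∀ α : Fin d → ℕ, ∑ i, α i ≤ k → α ∈ dom m) : IsWeakJet Ω k p (jet Ω u) where
  measurable α _ := measurable_jet hΩ u α
  eq_zero α _ _ hx := jet_eq_zero u α hx
  memLp α hα := by
    have h := hu.memLp_weakDeriv hΩ (hk α hα)
    refine ⟨(measurable_jet hΩ u α).aestronglyMeasurable, ?_⟩
    rw [eLpNorm_jet hΩ h.1]
    exact h.2
  hasWeakDirDeriv α i hα φ hφ hc hs := by
    have hα0 : ∑ i, α i ≤ k := by omega
    have hα1 : ∑ j, (α + Pi.single i 1 : Fin d → ℕ) j ≤ k := by rw [sum_add_single]; exact hα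
    have hv := (hu.memLp_weakDeriv hΩ (hk α hα0)).1
    have hw := (hu.memLp_weakDeriv hΩ (hk _ hα1)).1
    obtain ⟨_, hv', -⟩ := hu α (hk α hα0)
    obtain ⟨_, hw', -⟩ := hu _ (hk _ hα1)
    have key := hv'.weakDeriv.setIntegral_mul_fderiv hw'.weakDeriv hφ hc hs
    rw [← setIntegral_mul_eq_integral (Ω := Ω) (jet Ω u (α + Pi.single i 1)) hs,
      ← setIntegral_mul_eq_integral (Ω := Ω) (jet Ω u α)
        ((tsupport_fderiv_apply_subset ℝ _).trans hs)]
    refine Eq.trans (integral_congr_ae ?_) (key.trans (congrArg Neg.neg (integral_congr_ae ?_)))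
    · filter_upwards [jet_ae_eq hΩ hv] with x hx
      rw [hx]
    · filter_upwards [jet_ae_eq hΩ hw] with x hx
      rw [hx]

end WeakDerivatives

/-! ### Interpolation between Lebesgue norms. -/

section Interpolation

variable {α : Type*} [MeasurableSpace α] {μ : Measure α}

/-- Hölder for `|f|^q = (|f|^r)^(qθ/r) (|f|^p)^(q(1-θ)/p)`, whose outer exponents sum to one by the
relation on `q`. -/
theorem eLpNorm_le_rpow_mul_rpow {p q r θ : ℝ} (hp : 0 < p) (hq : 0 < q) (hr : 0 < r)
    (hθ0 : 0 ≤ θ) (hθ1 : θ ≤ 1) (hq' : 1 / q = θ / r + (1 - θ) / p) {f : α → ℝ}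
    (hf : AEStronglyMeasurable f μ) :
    eLpNorm f (ENNReal.ofReal q) μ ≤
      eLpNorm f (ENNReal.ofReal r) μ ^ θ * eLpNorm f (ENNReal.ofReal p) μ ^ (1 - θ) := by
  have hθ2 : 0 ≤ 1 - θ := by linarith
  rw [eLpNorm_ofReal_eq hp, eLpNorm_ofReal_eq hq, eLpNorm_ofReal_eq hr]
  have hab : q * θ / r + q * (1 - θ) / p = 1 := by
    calc q * θ / r + q * (1 - θ) / p = q * (θ / r + (1 - θ) / p) := by ring
      _ = 1 := by rw [← hq']; field_simp
  have h1 := ENNReal.lintegral_mul_norm_pow_le (μ := μ) (f := fun x => ‖f x‖ₑ ^ r)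
    (g := fun x => ‖f x‖ₑ ^ p) (hf.enorm.pow_const r) (hf.enorm.pow_const p)
    (show 0 ≤ q * θ / r by positivity) (show 0 ≤ q * (1 - θ) / p by positivity) hab
  have h2 : ∀ x, (‖f x‖ₑ ^ r) ^ (q * θ / r) * (‖f x‖ₑ ^ p) ^ (q * (1 - θ) / p) = ‖f x‖ₑ ^ q := by
    intro x
    rw [← ENNReal.rpow_mul, ← ENNReal.rpow_mul,
      ← ENNReal.rpow_add_of_nonneg _ _ (by positivity) (by positivity)]
    congr 1
    field_simp
    ring
  simp only [h2] at h1
  refine (ENNReal.rpow_le_rpow h1 (show 0 ≤ 1 / q by positivity)).trans_eq ?_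
  rw [ENNReal.mul_rpow_of_nonneg _ _ (by positivity), ← ENNReal.rpow_mul, ← ENNReal.rpow_mul,
    ← ENNReal.rpow_mul, ← ENNReal.rpow_mul]
  congr 2 <;> field_simp

theorem eLpNorm_le_top_rpow_mul_rpow {p q : ℝ} (hp : 0 < p) (hpq : p ≤ q) {f : α → ℝ}
    (hf : AEStronglyMeasurable f μ) :
    eLpNorm f (ENNReal.ofReal q) μ ≤
      eLpNorm f ⊤ μ ^ (1 - p / q) * eLpNorm f (ENNReal.ofReal p) μ ^ (p / q) := by
  have hq : 0 < q := hp.trans_le hpq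
  rw [eLpNorm_ofReal_eq hp, eLpNorm_ofReal_eq hq, eLpNorm_exponent_top]
  have h1 : ∫⁻ x, ‖f x‖ₑ ^ q ∂μ ≤ eLpNormEssSup f μ ^ (q - p) * ∫⁻ x, ‖f x‖ₑ ^ p ∂μ := by
    rw [← lintegral_const_mul'' _ (hf.enorm.pow_const p)]
    refine lintegral_mono_ae ?_
    filter_upwards [enorm_ae_le_eLpNormEssSup f μ] with x hx
    calc ‖f x‖ₑ ^ q = ‖f x‖ₑ ^ (q - p) * ‖f x‖ₑ ^ p := by
          rw [← ENNReal.rpow_add_of_nonneg _ _ (by linarith) hp.le, sub_add_cancel]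
      _ ≤ _ := by gcongr
  refine (ENNReal.rpow_le_rpow h1 (show 0 ≤ 1 / q by positivity)).trans_eq ?_
  rw [ENNReal.mul_rpow_of_nonneg _ _ (by positivity), ← ENNReal.rpow_mul, ← ENNReal.rpow_mul]
  congr 2 <;> field_simp

end Interpolation

/-! ### Reduction to the isotropic order and interpolation in `q`. -/

section Embedding

theorem minEntry_le {d : ℕ} (m : Fin d → ℕ) (i : Fin d) : minEntry m ≤ m i :=
  ciInf_le (OrderBot.bddBelow _) i

theorem one_le_minEntry {d : ℕ} (hd : 1 ≤ d) {m : Fin d → ℕ} (hm : ∀ i, 1 ≤ m i) :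
    1 ≤ minEntry m := by
  have : Nonempty (Fin d) := ⟨⟨0, hd⟩⟩
  exact le_ciInf hm

theorem minEntry_le_maxEntry {d : ℕ} (hd : 1 ≤ d) (m : Fin d → ℕ) :
    minEntry m ≤ maxEntry m :=
  (minEntry_le m ⟨0, hd⟩).trans (le_ciSup (Set.finite_range m).bddAbove _)

/-- Replacing every `m i` by the smallest entry only increases the anisotropic order. -/
theorem mem_dom_of_sum_le {d : ℕ} (hd : 1 ≤ d) {m : Fin d → ℕ} (hm : ∀ i, 1 ≤ m i)
    {α : Fin d → ℕ} (hα : ∑ i, α i ≤ minEntry m) : α ∈ dom m := by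
  rw [mem_dom hm]
  have hk : (0 : ℚ) < minEntry m := by exact_mod_cast one_le_minEntry hd hm
  calc ∑ i, (α i : ℚ) / (m i : ℚ) ≤ ∑ i, (α i : ℚ) / (minEntry m : ℚ) := by
        refine Finset.sum_le_sum fun i _ => ?_
        have : (minEntry m : ℚ) ≤ m i := by exact_mod_cast minEntry_le m i
        gcongr
    _ = ((∑ i, α i : ℕ) : ℚ) / minEntry m := by rw [← Finset.sum_div]; push_cast; rfl
    _ ≤ 1 := by
        rw [div_le_one hk]
        exact_mod_cast hα

/-- The embedding for weak jets, for `kp > d` and `q = ∞` or `q < ∞`, and for `kp < d`. -/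
theorem exists_eLpNorm_le_rpow_mul_rpow_of_isWeakJet {d : ℕ} {k : ℕ} (hk : 1 ≤ k) {p : ℝ}
    (hp : 1 ≤ p) {q : ℝ≥0∞} (hpq : ENNReal.ofReal p ≤ q)
    (hq : (d : ℝ) < k * p ∨ ((k * p : ℝ) < d ∧ q ≤ ENNReal.ofReal (d * p / (d - k * p))))
    (s : Finset (EuclideanSpace ℝ (Fin d))) {δ : ℝ} (hδ : 0 < δ) :
    ∃ K : ℝ≥0, ∀ Ω : Set (EuclideanSpace ℝ (Fin d)), IsOpen Ω →
      (∀ x ∈ Ω, ∃ c ∈ s, x ∈ coneCore Ω c δ) → ∀ U, IsWeakJet Ω k p U →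
      eLpNorm (U 0) q volume ≤ K *
        (∑ β ∈ ordLE d k, eLpNorm (U β) (ENNReal.ofReal p) volume) ^
          ((d : ℝ) / k * p⁻¹ - d / k * (q⁻¹).toReal) *
          eLpNorm (U 0) (ENNReal.ofReal p) volume ^
            (1 - ((d : ℝ) / k * p⁻¹ - d / k * (q⁻¹).toReal)) := by
  have hk0 : (0 : ℝ) < k := by exact_mod_cast hk
  have hp0 : 0 < p := by linarith
  rcases hq with hkp | ⟨hkp, hqr⟩
  · obtain ⟨K, hK⟩ := exists_eLpNorm_top_le_of_isWeakJet hk hp hkp s hδ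
    have ht : (d : ℝ) / k * p⁻¹ = d / (k * p) := by field_simp
    rcases eq_or_ne q ⊤ with rfl | hqtop
    · refine ⟨K, fun Ω hΩ hcov U hU => ?_⟩
      simpa [ht] using hK Ω hΩ hcov U hU
    · obtain ⟨Q, hQ0, rfl⟩ : ∃ Q : ℝ, 0 ≤ Q ∧ q = ENNReal.ofReal Q :=
        ⟨q.toReal, ENNReal.toReal_nonneg, (ENNReal.ofReal_toReal hqtop).symm⟩
      have hpQ : p ≤ Q := (ENNReal.ofReal_le_ofReal_iff hQ0).1 hpq
      have hQ : 0 < Q := by linarith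
      have hpQ1 : p / Q ≤ 1 := (div_le_one hQ).2 hpQ
      have hpQ1' : 0 ≤ 1 - p / Q := by linarith
      have ht1 : d / (k * p) ≤ 1 := (div_le_one (by positivity)).2 hkp.le
      refine ⟨K ^ (1 - p / Q), fun Ω hΩ hcov U hU => ?_⟩
      set N := ∑ β ∈ ordLE d k, eLpNorm (U β) (ENNReal.ofReal p) volume with hN
      set A := eLpNorm (U 0) (ENNReal.ofReal p) volume with hA
      have hU0 : Measurable (U 0) := hU.measurable 0 (by simp)
      have e1 := eLpNorm_le_top_rpow_mul_rpow hp0 hpQ hU0.aestronglyMeasurable (μ := volume)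
      have e2 := ENNReal.rpow_le_rpow (hK Ω hΩ hcov U hU) hpQ1'
      -- The exponent is the one of the `L_∞` bound times the weight `1 - p / Q` of `L_∞` in the
      -- interpolation.
      have hθ : (d : ℝ) / k * p⁻¹ - d / k * ((ENNReal.ofReal Q)⁻¹).toReal =
          d / (k * p) * (1 - p / Q) := by
        rw [ENNReal.toReal_inv, ENNReal.toReal_ofReal hQ0]; field_simp
      rw [hθ]
      refine (e1.trans (mul_le_mul_left e2 _)).trans_eq ?_
      rw [ENNReal.mul_rpow_of_nonneg _ _ hpQ1', ENNReal.mul_rpow_of_nonneg _ _ hpQ1',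
        ← ENNReal.rpow_mul, ← ENNReal.rpow_mul, mul_assoc,
        ← ENNReal.rpow_add_of_nonneg _ _ (mul_nonneg (by linarith) hpQ1') (by positivity),
        ENNReal.coe_rpow_of_nonneg _ hpQ1']
      congr 2
      ring
  · obtain ⟨K, hK⟩ := exists_eLpNorm_le_of_isWeakJet hp hkp s hδ (le_refl k)
    have hdk : 0 < d - k * p := by linarith
    have hd0 : (0 : ℝ) < d := lt_of_le_of_lt (by positivity) hkp
    obtain ⟨Q, hQ0, rfl⟩ : ∃ Q : ℝ, 0 ≤ Q ∧ q = ENNReal.ofReal Q :=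
      ⟨q.toReal, ENNReal.toReal_nonneg,
        (ENNReal.ofReal_toReal (ne_top_of_le_ne_top ENNReal.ofReal_ne_top hqr)).symm⟩
    have hpQ : p ≤ Q := (ENNReal.ofReal_le_ofReal_iff hQ0).1 hpq
    have hQ : 0 < Q := by linarith
    have hR : 0 < d * p / (d - k * p) := by positivity
    have hQR : Q ≤ d * p / (d - k * p) := (ENNReal.ofReal_le_ofReal_iff hR.le).1 hqr
    have hθ : (d : ℝ) / k * p⁻¹ - d / k * ((ENNReal.ofReal Q)⁻¹).toReal =
        d / k * (1 / p - 1 / Q) := by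
      rw [ENNReal.toReal_inv, ENNReal.toReal_ofReal hQ0]; field_simp
    rw [hθ]
    set θ : ℝ := d / k * (1 / p - 1 / Q) with hθdef
    -- In reciprocals the endpoint is `1/p - k/d`, so `θ` is the position of `1/Q` between `1/p` and
    -- this value; `θ ≤ 1` is the upper bound on `Q`.
    have hinv : 1 / (d * p / (d - k * p)) = 1 / p - k / d := by field_simp
    have hθ0 : 0 ≤ θ := by
      have : 1 / Q ≤ 1 / p := one_div_le_one_div_of_le hp0 hpQ
      exact mul_nonneg (by positivity) (by linarith)
    have hθ1 : θ ≤ 1 := by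
      have h1 : 1 / (d * p / (d - k * p)) ≤ 1 / Q := one_div_le_one_div_of_le hQ hQR
      rw [hinv] at h1
      calc θ ≤ d / k * (k / d) := by
            rw [hθdef]
            exact mul_le_mul_of_nonneg_left (by linarith) (by positivity)
        _ = 1 := by field_simp
    have hq' : 1 / Q = θ / (d * p / (d - k * p)) + (1 - θ) / p := by
      rw [div_eq_mul_one_div θ, hinv, hθdef]
      field_simp
      ring
    refine ⟨K ^ θ, fun Ω hΩ hcov U hU => ?_⟩
    have hU0 : Measurable (U 0) := hU.measurable 0 (by simp)
    refine (eLpNorm_le_rpow_mul_rpow hp0 hQ hR hθ0 hθ1 hq' hU0.aestronglyMeasurable).trans ?_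
    gcongr
    rw [ENNReal.coe_rpow_of_nonneg _ hθ0, ← ENNReal.mul_rpow_of_nonneg _ _ hθ0]
    exact ENNReal.rpow_le_rpow (hK Ω hΩ hcov U hU 0 (by simp)) hθ0

end Embedding

end AnisoSobolev

/-! ### Assembly of the anisotropic theorem. -/

theorem mainTheorem11 (d : ℕ) (hd : 1 ≤ d) (m : Fin d → ℕ) (hm : ∀ i, 1 ≤ m i)
    (p q : ℝ≥0∞) (hp : 1 ≤ p) (hpq : p ≤ q)
    (hq : (d : ℝ≥0∞) < (AnisoSobolev.minEntry m : ℝ≥0∞) * p ∨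
      ((AnisoSobolev.maxEntry m : ℝ≥0∞) * p < (d : ℝ≥0∞) ∧
        q ≤ (d : ℝ≥0∞) * p / ((d : ℝ≥0∞) - (AnisoSobolev.minEntry m : ℝ≥0∞) * p)))
    (ρ κ : ℝ) (hρ : 0 < ρ) (hκ : 0 < κ) (hκπ : κ ≤ Real.pi) :
    ∃ K : ℝ≥0, ∀ Ω : Set (EuclideanSpace ℝ (Fin d)), IsOpen Ω →
      AnisoSobolev.ConeCondition Ω ρ κ →
      ∀ u : EuclideanSpace ℝ (Fin d) → ℝ, AnisoSobolev.MemSobolev Ω m p u →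
        eLpNorm u q (volume.restrict Ω) ≤
          (K : ℝ≥0∞) * AnisoSobolev.sobolevNorm Ω m p u ^ AnisoSobolev.theta m p q *
            eLpNorm u p (volume.restrict Ω) ^ (1 - AnisoSobolev.theta m p q) := by
  open AnisoSobolev in
  -- For `p = q` the exponent `θ` is zero and `K = 1` works; this also disposes of `p = ∞`, so a
  -- real exponent remains.
  rcases hpq.eq_or_lt with rfl | hlt
  · refine ⟨1, fun Ω _ _ u _ => ?_⟩
    simp [theta]
  have hptop : p ≠ ⊤ := hlt.ne_top
  obtain ⟨P, hP0, rfl⟩ : ∃ P : ℝ, 0 ≤ P ∧ p = ENNReal.ofReal P :=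
    ⟨p.toReal, ENNReal.toReal_nonneg, (ENNReal.ofReal_toReal hptop).symm⟩
  have hP : 1 ≤ P := by simpa using hp
  have hk := one_le_minEntry hd hm
  set k := minEntry m with hkdef
  have hmul : ∀ n : ℕ, (n : ℝ≥0∞) * ENNReal.ofReal P = ENNReal.ofReal (n * P) := fun n => by
    rw [ENNReal.ofReal_mul (Nat.cast_nonneg n), ENNReal.ofReal_natCast]
  have hq' : (d : ℝ) < k * P ∨
      ((k * P : ℝ) < d ∧ q ≤ ENNReal.ofReal (d * P / (d - k * P))) := by
    rcases hq with h | ⟨h1, h2⟩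
    · left
      rw [hmul, ← ENNReal.ofReal_natCast d] at h
      exact (ENNReal.ofReal_lt_ofReal_iff_of_nonneg (Nat.cast_nonneg d)).1 h
    · right
      rw [hmul, ← ENNReal.ofReal_natCast d] at h1
      have h3 := (ENNReal.ofReal_lt_ofReal_iff_of_nonneg (by positivity)).1 h1
      -- Passing to the smallest entry gives `kP < d`, so the truncated subtraction in `ℝ≥0∞` agrees
      -- with the real one and the denominator is positive.
      have h4 : (k : ℝ) ≤ maxEntry m := by exact_mod_cast minEntry_le_maxEntry hd m
      have h5 : (k * P : ℝ) < d := lt_of_le_of_lt (by gcongr) h3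
      refine ⟨h5, h2.trans_eq ?_⟩
      rw [hmul, hmul, ENNReal.ofReal_div_of_pos (by linarith), ENNReal.ofReal_sub _ (by positivity),
        ENNReal.ofReal_natCast]
  obtain ⟨δ, hδ, s, hs⟩ := exists_finset_forall_coneCondition (d := d) hρ hκ hκπ
  obtain ⟨K, hK⟩ := exists_eLpNorm_le_rpow_mul_rpow_of_isWeakJet hk hP hpq hq' s hδ
  refine ⟨K, fun Ω hΩ hcone u hu => ?_⟩
  have hdom : ∀ α : Fin d → ℕ, ∑ i, α i ≤ k → α ∈ dom m := fun α hα => mem_dom_of_sum_le hd hm hα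
  have hmeas : ∀ α : Fin d → ℕ, ∑ i, α i ≤ k →
      AEStronglyMeasurable (weakDeriv Ω α u) (volume.restrict Ω) := fun α hα =>
    (hu.memLp_weakDeriv hΩ (hdom α hα)).1
  have h0 : ∑ i, (0 : Fin d → ℕ) i ≤ k := by simp
  have hu0 : u =ᵐ[volume.restrict Ω] weakDeriv Ω 0 u := by
    obtain ⟨v, hv, -⟩ := hu 0 (hdom 0 h0)
    exact (hasWeakDeriv_zero hv.1).ae_eq hΩ hv.weakDeriv
  have hnorm : ∀ r : ℝ≥0∞, eLpNorm (jet Ω u 0) r volume = eLpNorm u r (volume.restrict Ω) :=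
    fun r => by rw [eLpNorm_jet hΩ (hmeas 0 h0), eLpNorm_congr_ae hu0]
  have hsum : ∑ β ∈ ordLE d k, eLpNorm (jet Ω u β) (ENNReal.ofReal P) volume ≤
      sobolevNorm Ω m (ENNReal.ofReal P) u := by
    rw [sobolevNorm, Finset.sum_congr rfl fun β hβ =>
      eLpNorm_jet hΩ (hmeas β (mem_ordLE.1 hβ)) (ENNReal.ofReal P)]
    exact Finset.sum_le_sum_of_subset fun β hβ => hdom β (mem_ordLE.1 hβ)
  have hθ : theta m (ENNReal.ofReal P) q = (d : ℝ) / k * P⁻¹ - d / k * (q⁻¹).toReal := by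
    rw [theta, ENNReal.toReal_inv, ENNReal.toReal_ofReal hP0]
  have key := hK Ω hΩ (fun x hx => hs Ω hcone x hx) (jet Ω u) (hu.isWeakJet hΩ hdom)
  rw [hnorm, hnorm, ← hθ] at key
  refine key.trans ?_
  gcongr
  -- Enlarging the jet norm to the full Sobolev norm under the power requires `θ ≥ 0`, which is `p ≤
  -- q`.
  rw [hθ, ← mul_sub]
  refine mul_nonneg (by positivity) (sub_nonneg.2 ?_)
  rw [← ENNReal.toReal_ofReal hP0, ← ENNReal.toReal_inv]
  exact ENNReal.toReal_mono (ENNReal.inv_ne_top.2 (by simpa using (by linarith : 0 < P)))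
    (ENNReal.inv_le_inv.2 hpq)
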